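/- Let $\mathfrak g$ be a complex semisimple Lie algebra (the complexified Lie algebra of a compact semisimple gauge group), $\mathfrak h$ a Cartan subalgebra with root set $R$ and base $\Sigma$, and $(\cdot,\cdot)$ an invariant bilinear form on $\mathfrak g$ that is a positive multiple of the Killing form on each simple ideal, distinct simple ideals being orthogonal. For $\alpha\in R$ let $h_\alpha\in\mathfrak h$ be the coroot and $|\alpha|^2=4/(h_\alpha,h_\alpha)$ its squared length. Let $W_0\in\mathfrak h$ be an $A_1$-vector (the neutral element of an $\mathfrak{sl}(2)$-triple) in the open fundamental Weyl chamber, i.e. $\alpha(W_0)>0$ for all $\alpha\in\Sigma$; let $\Sigma_w=\{\alpha\in R:\alpha(W_0)=2\}=\{\alpha_1,\dots,\alpha_L\}$, and put $$C_{ij}=\alpha_i(h_{\alpha_j}),\qquad h_{ij}=(h_{\alpha_i},h_{\alpha_j}),\qquad w_j=2\sum_l (C^{-1})_{jl}.$$ Let $k\in\{1,0,-1\}$ and $\ell>0$. For real functions $m,S,\omega_1,\dots,\omega_L,\mathcal E_1,\dots,\mathcal E_L$ of $r>0$ write $'=d/dr$ and $$\mu=k-\frac{2m}{r}+\frac{r^2}{\ell^2},\quad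 a_i'=\sum_j (C^{-1})_{ij}\mathcal E_j',\quad \eta=\tfrac12\sum_{i,j}a_i'h_{ij}a_j',\quad \zeta=\sum_i\frac{\mathcal E_i^2\omega_i^2}{|\alpha_i|^2},\quad G=\sum_i\frac{\omega_i'^2}{|\alpha_i|^2},$$ $$P=\tfrac18\sum_{i,j}(kw_i-\omega_i^2)h_{ij}(kw_j-\omega_j^2),\quad \mathcal F_i=\frac{\omega_i}{2}\sum_jC_{ij}(kw_j-\omega_j^2),\quad \mathcal Z_i=\sum_jC_{ij}\mathcal E_j\omega_j^2 .$$ The field equations are $$m'=\frac{r^2\eta}{S^2}+\frac{\zeta}{\mu S^2}+\mu G+\frac{P}{r^2},\qquad \frac{S'}{S}=\frac{2G}{r}+\frac{2\zeta}{\mu^2S^2r},$$ $$0=\mathcal E_i''+\frac2r\Big(1-G-\frac{\zeta}{\mu^2S^2}\Big)\mathcal E_i'-\frac{\mathcal Z_i}{\mu r^2},$$ $$0=r^2\mu\,\omega_i''+2\Big(m-\frac Pr-\frac{r^3\eta}{S^2}+\frac{r^3}{\ell^2}\Big)\omega_i'+\frac{r^2\mathcal E_i^2\omega_i}{\mu S^2}+\mathcal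 F_i .$$ A solution on $r>R$ (with $R>0$) means that these hold for all $r>R$, with $\mu>0$, $S>0$, $m,S$ differentiable and $\omega_i,\mathcal E_i$ twice differentiable there. **Proposition.** Let $z=1/r$. The $4L+1$ real parameters $c=(M,\omega_{i,\infty},\omega_{i,1},\mathcal E_{i,\infty},\mathcal E_{i,1})_{1\le i\le L}$ are arbitrary: for every $c_0\in\mathbb R^{4L+1}$ there are $\varepsilon>0$, an open neighbourhood $U$ of $c_0$ and real functions $m,S,\omega_i,\mathcal E_i$ of $(z,c)$, jointly analytic on $(-\varepsilon,\varepsilon)\times U$, such that for every $c\in U$ the functions $r\mapsto m(1/r,c)$, $S(1/r,c)$, $\omega_i(1/r,c)$, $\mathcal E_i(1/r,c)$ solve the field equations on $r>1/\varepsilon$ and, as $z\to0^+$, $$m=M+O(z),\quad S=1+O(z^4),\quad \omega_i=\omega_{i,\infty}+\omega_{i,1}z+O(z^2),\quad \mathcal E_i=\mathcal E_{i,\infty}+\mathcal E_{i,1}z+O(z^2).$$ This solution is unique: for every $R>0$, every solution on $r>R$ that has these expansions with the same $c$ coincides with it for all $r>\max(R,1/\varepsilon)$. -/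

import Mathlib

open Filter Topology Asymptotics

/-!  The static dyonic Einstein-Yang-Mills equations with topological symmetry and `Λ < 0`,
for a regular model with compact semisimple gauge group, written in components. -/

noncomputable section

namespace EYM

/-! ### The Lie-algebraic data

`g` is the complexified Lie algebra of the gauge group, `H` a Cartan subalgebra. -/

section LieData

variable {g : Type*} [LieRing g] [LieAlgebra ℂ g] [FiniteDimensional ℂ g]
  [LieAlgebra.IsKilling ℂ g] {H : LieSubalgebra ℂ g} [H.IsCartanSubalgebra]

/-- The admissible invariant inner products `( , )` on `g`: on every simple ideal (a minimal
nonzero ideal) a positive multiple of the Killing form, distinct simple ideals being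
orthogonal. -/
def IsAdmissibleForm (B : LinearMap.BilinForm ℂ g) : Prop :=
  ∀ I : LieIdeal ℂ g, IsAtom I →
    ∃ c : ℝ, 0 < c ∧ ∀ x ∈ I, ∀ y : g, B x y = (c : ℂ) * killingForm ℂ g x y

/-- `W₀` lies in the open fundamental Weyl chamber of the base `b`: every simple root takes a
positive real value on it. -/
def InOpenWeylChamber (b : (LieAlgebra.IsKilling.rootSystem H).Base) (W₀ : H) : Prop :=
  ∀ i ∈ b.support, ∃ x : ℝ, 0 < x ∧ i.1 W₀ = (x : ℂ)

/-- `W₀` is an `A₁`-vector: the neutral element of a standard triple spanning an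
`sl(2)`-subalgebra of `g`. -/
def IsA1Vector (W₀ : H) : Prop :=
  ∃ e f : g, IsSl2Triple (W₀ : g) e f

open Classical in
/-- The set of roots `Σ_w = {α ∈ R | α(W₀) = 2}`. -/
def sigmaW (W₀ : H) : Finset H.root :=
  Finset.univ.filter fun α => α.1 W₀ = 2

instance (W₀ : H) : DecidableEq (sigmaW W₀) := Classical.decEq _

/-- The coroot `h_α = 2 t_α / |α|²`, where `(t_α, X) = α(X)` on `H`; it is normalized by
`α(h_α) = 2` and therefore does not depend on the choice of the inner product. -/
def hvec (α : H.root) : g :=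
  ((LieAlgebra.IsKilling.rootSystem H).coroot α : H)

/-- `|α|² = (t_α, t_α)`. Since `h_α = 2 t_α / |α|²`, one has `(h_α, h_α) = 4 / |α|²`. -/
def rootNormSq (B : LinearMap.BilinForm ℂ g) (α : H.root) : ℝ :=
  4 / (B (hvec α) (hvec α)).re

end LieData

/-- The constants of the field equations: the Cartan matrix `C`, the Gram matrix `h` of the
coroots and the squared lengths `|α_i|²` of the roots. -/
structure Coeffs (ι : Type*) where
  C : Matrix ι ι ℝ
  h : Matrix ι ι ℝ
  normSq : ι → ℝ

/-- The constants of the model given by `W₀` and the inner product `B`, indexed by `Σ_w`: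
`C_{ij} = ⟨α_i, α_j⟩ = α_i(h_j)`, `h_{ij} = (h_i, h_j)`, `|α_i|²`. -/
def modelCoeffs {g : Type*} [LieRing g] [LieAlgebra ℂ g] [FiniteDimensional ℂ g]
    [LieAlgebra.IsKilling ℂ g] {H : LieSubalgebra ℂ g} [H.IsCartanSubalgebra]
    (B : LinearMap.BilinForm ℂ g) (W₀ : H) : Coeffs (sigmaW W₀) where
  C := Matrix.of fun i j => ((LieAlgebra.IsKilling.rootSystem H).pairingIn ℤ i.1 j.1 : ℝ)
  h := Matrix.of fun i j => (B (hvec i.1) (hvec j.1)).re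
  normSq := fun i => rootNormSq B i.1

/-! ### The field equations -/

/-- The field variables, as functions of the radial coordinate `r`: the mass function `m`, the
lapse `S`, the magnetic functions `ω_i` and the electric functions `E_i`. -/
structure Fields (ι : Type*) where
  m : ℝ → ℝ
  S : ℝ → ℝ
  ω : ι → ℝ → ℝ
  E : ι → ℝ → ℝ

section Equations

variable {ι : Type*} [Fintype ι] [DecidableEq ι]

namespace Coeffs

/-- `w_j = 2 ∑_l (C⁻¹)_{jl}`. -/
def w (K : Coeffs ι) (j : ι) : ℝ := 2 * ∑ l, K.C⁻¹ j l

/-- `k w_j - ω_j²`. -/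
def defect (K : Coeffs ι) (k : ℝ) (Φ : Fields ι) (r : ℝ) (j : ι) : ℝ :=
  k * K.w j - Φ.ω j r ^ 2

/-- `μ = k - 2m/r + r²/ℓ²`. -/
def mu (k ℓ : ℝ) (Φ : Fields ι) (r : ℝ) : ℝ := k - 2 * Φ.m r / r + r ^ 2 / ℓ ^ 2

/-- `a_i'`, where the `a_i` are the components of the electric potential along the coroots,
so that `E_i = ∑_j C_{ij} a_j`. -/
def aDeriv (K : Coeffs ι) (Φ : Fields ι) (r : ℝ) (i : ι) : ℝ :=
  ∑ j, K.C⁻¹ i j * deriv (Φ.E j) r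

/-- `η = ½ ∑_{ij} a_i' h_{ij} a_j'`. -/
def eta (K : Coeffs ι) (Φ : Fields ι) (r : ℝ) : ℝ :=
  (1 / 2) * ∑ i, ∑ j, K.aDeriv Φ r i * K.h i j * K.aDeriv Φ r j

/-- `ζ = ∑_i E_i² ω_i² / |α_i|²`. -/
def zeta (K : Coeffs ι) (Φ : Fields ι) (r : ℝ) : ℝ :=
  ∑ i, Φ.E i r ^ 2 * Φ.ω i r ^ 2 / K.normSq i

/-- `G = ∑_i ω_i'² / |α_i|²`. -/
def G (K : Coeffs ι) (Φ : Fields ι) (r : ℝ) : ℝ :=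
  ∑ i, deriv (Φ.ω i) r ^ 2 / K.normSq i

/-- `P = ⅛ ∑_{ij} (k w_i - ω_i²) h_{ij} (k w_j - ω_j²)`. -/
def P (K : Coeffs ι) (k : ℝ) (Φ : Fields ι) (r : ℝ) : ℝ :=
  (1 / 8) * ∑ i, ∑ j, K.defect k Φ r i * K.h i j * K.defect k Φ r j

/-- `F_i = (ω_i / 2) ∑_j C_{ij} (k w_j - ω_j²)`. -/
def F (K : Coeffs ι) (k : ℝ) (Φ : Fields ι) (r : ℝ) (i : ι) : ℝ :=
  Φ.ω i r / 2 * ∑ j, K.C i j * K.defect k Φ r j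

/-- `Z_i = ∑_j C_{ij} E_j ω_j²`. -/
def Z (K : Coeffs ι) (Φ : Fields ι) (r : ℝ) (i : ι) : ℝ :=
  ∑ j, K.C i j * Φ.E j r * Φ.ω j r ^ 2

end Coeffs

open Coeffs in
/-- `Φ` is a regular solution of the Einstein and Yang-Mills equations for `r > R` (where
`R > 0`); `μ > 0` and `S > 0` say that the metric is static and nondegenerate there. -/
structure IsSolutionBeyond (K : Coeffs ι) (k ℓ R : ℝ) (Φ : Fields ι) : Prop where
  mu_pos : ∀ r, R < r → 0 < mu k ℓ Φ r
  S_pos : ∀ r, R < r → 0 < Φ.S r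
  diff_m : ∀ r, R < r → DifferentiableAt ℝ Φ.m r
  diff_S : ∀ r, R < r → DifferentiableAt ℝ Φ.S r
  diff_ω : ∀ i r, R < r → DifferentiableAt ℝ (Φ.ω i) r
  diff_E : ∀ i r, R < r → DifferentiableAt ℝ (Φ.E i) r
  diff_ω' : ∀ i r, R < r → DifferentiableAt ℝ (deriv (Φ.ω i)) r
  diff_E' : ∀ i r, R < r → DifferentiableAt ℝ (deriv (Φ.E i)) r
  einstein_m : ∀ r, R < r →
    deriv Φ.m r = r ^ 2 * K.eta Φ r / Φ.S r ^ 2 + K.zeta Φ r / (mu k ℓ Φ r * Φ.S r ^ 2)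
      + mu k ℓ Φ r * K.G Φ r + K.P k Φ r / r ^ 2
  einstein_S : ∀ r, R < r →
    deriv Φ.S r / Φ.S r
      = 2 * K.G Φ r / r + 2 * K.zeta Φ r / (mu k ℓ Φ r ^ 2 * Φ.S r ^ 2 * r)
  ym_E : ∀ i r, R < r →
    0 = deriv (deriv (Φ.E i)) r
      + 2 / r * (1 - K.G Φ r - K.zeta Φ r / (mu k ℓ Φ r ^ 2 * Φ.S r ^ 2)) * deriv (Φ.E i) r
      - K.Z Φ r i / (mu k ℓ Φ r * r ^ 2)
  ym_ω : ∀ i r, R < r →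
    0 = r ^ 2 * mu k ℓ Φ r * deriv (deriv (Φ.ω i)) r
      + 2 * (Φ.m r - K.P k Φ r / r - r ^ 3 * K.eta Φ r / Φ.S r ^ 2 + r ^ 3 / ℓ ^ 2)
          * deriv (Φ.ω i) r
      + r ^ 2 * Φ.E i r ^ 2 * Φ.ω i r / (mu k ℓ Φ r * Φ.S r ^ 2)
      + K.F k Φ r i

end Equations

/-! ### Data at infinity -/

/-- The parameters `(M, ω_{i,∞}, ω_{i,1}, E_{i,∞}, E_{i,1})`. -/
abbrev DataAtInfinity (ι : Type*) : Type _ :=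
  ℝ × (ι → ℝ) × (ι → ℝ) × (ι → ℝ) × (ι → ℝ)

/-- The expansions at infinity, with `z = r⁻¹`: `m = M + O(z)`, `S = 1 + O(z⁴)`,
`ω_i = ω_{i,∞} + ω_{i,1} z + O(z²)`, `E_i = E_{i,∞} + E_{i,1} z + O(z²)`. -/
def HasExpansion {ι : Type*} (Φ : Fields ι) : DataAtInfinity ι → Prop
  | (M, ωinf, ω1, Einf, E1) =>
    ((fun r : ℝ => Φ.m r - M) =O[atTop] fun r : ℝ => r⁻¹) ∧
    ((fun r : ℝ => Φ.S r - 1) =O[atTop] fun r : ℝ => r⁻¹ ^ 4) ∧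
    (∀ i, (fun r : ℝ => Φ.ω i r - (ωinf i + ω1 i * r⁻¹)) =O[atTop] fun r : ℝ => r⁻¹ ^ 2) ∧
    (∀ i, (fun r : ℝ => Φ.E i r - (Einf i + E1 i * r⁻¹)) =O[atTop] fun r : ℝ => r⁻¹ ^ 2)

/-- A family of field variables, as functions of `(z, c)` with `z = r⁻¹` and `c` the data at
infinity. -/
structure FieldFamily (ι : Type*) where
  m : ℝ × DataAtInfinity ι → ℝ
  S : ℝ × DataAtInfinity ι → ℝ
  ω : ι → ℝ × DataAtInfinity ι → ℝ
  E : ι → ℝ × DataAtInfinity ι → ℝ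

/-- The member of the family with data `c`, as functions of `r`. -/
def FieldFamily.member {ι : Type*} (Ψ : FieldFamily ι) (c : DataAtInfinity ι) : Fields ι where
  m := fun r => Ψ.m (r⁻¹, c)
  S := fun r => Ψ.S (r⁻¹, c)
  ω := fun i r => Ψ.ω i (r⁻¹, c)
  E := fun i r => Ψ.E i (r⁻¹, c)

/-- All field variables of the family are jointly analytic in `(z, c)` on `s`. -/
structure FieldFamily.IsAnalyticOn {ι : Type*} [Fintype ι] (Ψ : FieldFamily ι)
    (s : Set (ℝ × DataAtInfinity ι)) : Prop where
  m : AnalyticOnNhd ℝ Ψ.m s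
  S : AnalyticOnNhd ℝ Ψ.S s
  ω : ∀ i, AnalyticOnNhd ℝ (Ψ.ω i) s
  E : ∀ i, AnalyticOnNhd ℝ (Ψ.E i) s

/-- Two sets of field variables coincide at the radius `r`. -/
def Fields.AgreeAt {ι : Type*} (Φ Φ' : Fields ι) (r : ℝ) : Prop :=
  Φ.m r = Φ'.m r ∧ Φ.S r = Φ'.S r ∧ (∀ i, Φ.ω i r = Φ'.ω i r) ∧ (∀ i, Φ.E i r = Φ'.E i r)

end EYM

end

/-! In the variable z = 1/r the point at infinity is an ordinary point of the equations. With λ =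
z²μ, which tends to 1/ℓ², the apparently singular terms cancel. Adjoining z, T = 1/S, q = 1/λ and
the z-derivatives v, e of ω, E as unknowns gives an autonomous system with polynomial right-hand
side (`Regularized.vectorField`). The parameters c, together with z = 0, S = T = 1 and q = ℓ², are
its initial values at z = 0, so nothing restricts them.

Existence and analyticity come from the flow of a polynomial vector field
(`exists_analyticAt_flow`). The relations TS = 1 and qλ = 1 propagate from z = 0, so integral curves
give back solutions. S' carries a factor z³, hence S = 1 + O(z⁴).

Uniqueness would be the usual one for initial value problems if v and e were known to converge as z
→ 0, but the assumed expansions concern ω and E only. The missing step is `tendsto_state`. In -dm/dz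
the terms quadratic in e and v, namely η and G up to powers of z, have a sign, and the rest is
bounded below. As m converges, these terms are integrable up to z = 0. The equations for v and e are
affine in v and e respectively, with growth rate at most a constant times 1 + η + G in the rescaled
quantities, so v and e stay bounded. Then the second derivatives of ω and E are bounded, and the
expansions may be differentiated.

The signs are those of |α_i|² and of the Gram matrix of the coroots (`modelCoeffs_normSq_pos`,
`modelCoeffs_h_nonneg`). They hold because on coroots the form is, up to positive rescaling, the
Killing form. -/

namespace EYM

/-! ### Positivity of the coroot Gram matrix. -/

section LiePositivity

open LieAlgebra LieAlgebra.IsKilling LieModule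

/-- The operator ad x ∘ ad y maps into I ∩ J, which is zero for distinct minimal ideals, so its
trace vanishes. -/
lemma killingForm_eq_zero_of_isAtom {g : Type*} [LieRing g]
    [LieAlgebra ℂ g] {I J : LieIdeal ℂ g} (hI : IsAtom I) (hJ : IsAtom J)
    (hIJ : I ≠ J) {x y : g} (hx : x ∈ I) (hy : y ∈ J) : killingForm ℂ g x y = 0 := by
  have hb : I ⊓ J = ⊥ := (hI.disjoint_of_ne hJ hIJ).eq_bot
  have : LieAlgebra.ad ℂ g x ∘ₗ LieAlgebra.ad ℂ g y = 0 := by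
    ext z
    rw [LinearMap.zero_apply, ← LieSubmodule.mem_bot (R := ℂ) (L := g), ← hb]
    exact ⟨lie_mem_left ℂ g I x _ hx, lie_mem_right ℂ g J x _ (lie_mem_left ℂ g J y z hy)⟩
  rw [killingForm_apply_apply, this, map_zero]

variable {g : Type*} [LieRing g] [LieAlgebra ℂ g] [FiniteDimensional ℂ g]
  [LieAlgebra.IsKilling ℂ g] {H : LieSubalgebra ℂ g} [H.IsCartanSubalgebra]

/-- Every root space lies in a simple ideal. -/
lemma exists_isAtom_rootSpace_le (α : H.root) :
    ∃ I : LieIdeal ℂ g, IsAtom I ∧ rootSpace H α.1 ≤ I.restr H := by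
  have hα : (α : Weight ℂ H g).IsNonZero := H.isNonZero_coe_root α
  obtain ⟨e, he, he0⟩ := α.1.exists_ne_zero
  have hlie : ∀ h : H, ⁅(h : g), e⁆ = α.1 h • e := fun h => lie_eq_smul_of_mem_rootSpace he h
  -- Otherwise the root vector e commutes with the sum of all simple ideals, hence is central, while
  -- the center is zero.
  obtain ⟨I, hI, y, hyI, hy⟩ : ∃ I : LieIdeal ℂ g, IsAtom I ∧ ∃ y ∈ I, ⁅y, e⁆ ≠ 0 := by
    by_contra! hcon
    have htop : (sSup {I : LieIdeal ℂ g | IsAtom I}).toSubmodule ≤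
        LinearMap.ker (LieAlgebra.ad ℂ g e) := by
      rw [LieSubmodule.sSup_toSubmodule]
      refine sSup_le ?_
      rintro _ ⟨I, hI, rfl⟩ y hy
      rw [LinearMap.mem_ker, LieAlgebra.ad_apply, ← lie_skew, hcon I hI y hy, neg_zero]
    rw [IsSemisimple.sSup_atoms_eq_top] at htop
    have hc : e ∈ LieAlgebra.center ℂ g := by
      rw [LieModule.mem_maxTrivSubmodule]
      intro x
      have : ⁅e, x⁆ = 0 := htop (show x ∈ _ from trivial)
      rw [← lie_skew, this, neg_zero]
    rw [LieAlgebra.center_eq_bot] at hc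
    exact he0 (by simpa using hc)
  -- Split e = a + b along I and the sum of the other simple ideals. The bracket with y shows a ≠ 0.
  -- The eigenvector equation splits too, so a is a root vector in I and spans the one-dimensional
  -- root space.
  have hx : e ∈ I ⊔ sSup ({I' : LieIdeal ℂ g | IsAtom I'} \ {I}) := by
    nth_rewrite 1 [← sSup_singleton (a := I)]
    rw [← sSup_union, Set.union_sdiff_self, Set.union_eq_self_of_subset_left,
      IsSemisimple.sSup_atoms_eq_top]
    · apply LieSubmodule.mem_top
    · simpa using hI
  have hdisj := (IsSemisimple.sSupIndep_isAtom (R := ℂ) (L := g) hI).eq_bot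
  rw [LieSubmodule.mem_sup] at hx
  obtain ⟨a, ha, b, hb, hab⟩ := hx
  have hzero : ∀ x : g, x ∈ I → x ∈ sSup ({I' : LieIdeal ℂ g | IsAtom I'} \ {I}) → x = 0 := by
    intro x hx hx'
    rw [← LieSubmodule.mem_bot (R := ℂ) (L := g), ← hdisj]
    exact ⟨hx, hx'⟩
  have ha0 : a ≠ 0 := by
    rintro rfl
    apply hy
    rw [← hab, zero_add]
    exact hzero _ (lie_mem_left ℂ g I y b hyI) (lie_mem_right ℂ g _ y b hb)
  have haw : ∀ h : H, ⁅(h : g), a⁆ = α.1 h • a := by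
    intro h
    rw [← sub_eq_zero]
    apply hzero _ (sub_mem (lie_mem_right ℂ g _ _ _ ha) (I.smul_mem _ ha))
    have : ⁅(h : g), a⁆ - α.1 h • a = α.1 h • b - ⁅(h : g), b⁆ := by
      have := hlie h
      rw [← hab, lie_add, smul_add] at this
      rw [sub_eq_sub_iff_add_eq_add, this, add_comm]
    rw [this]
    exact sub_mem ((sSup ({I' : LieIdeal ℂ g | IsAtom I'} \ {I})).smul_mem _ hb)
      (lie_mem_right ℂ g _ _ _ hb)
  have hamem : a ∈ rootSpace H α.1 := by
    apply weightSpace_le_genWeightSpace g (α.1 : H → ℂ)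
    rw [mem_weightSpace]
    exact haw
  refine ⟨I, hI, fun x hx => ?_⟩
  obtain ⟨c, hc⟩ := (finrank_eq_one_iff_of_nonzero' (⟨a, hamem⟩ : rootSpace H α.1)
        (by rwa [ne_eq, LieSubmodule.mk_eq_zero])).mp (finrank_rootSpace_eq_one α.1 hα) ⟨x, hx⟩
  have : x = c • a := by simpa using hc.symm
  rw [this]
  exact I.smul_mem c ha

lemma exists_isAtom_hvec_mem (α : H.root) : ∃ I : LieIdeal ℂ g, IsAtom I ∧ hvec α ∈ I := by
  obtain ⟨I, hI, h⟩ := exists_isAtom_rootSpace_le α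
  exact ⟨I, hI, I.corootSubmodule_le h (coe_coroot_mem_corootSubmodule α.1)⟩

/-- Up to positive rescaling of the coroots, the Gram matrix of an admissible form is the one of
the Killing form. -/
lemma IsAdmissibleForm.exists_scaling {B : LinearMap.BilinForm ℂ g} (hB : IsAdmissibleForm B) :
    ∃ s : H.root → ℝ, (∀ α, 0 < s α) ∧ ∀ α β : H.root,
      B (hvec α) (hvec β) = (s α * s β : ℝ) * killingForm ℂ g (hvec α) (hvec β) := by
  choose I hI hmem using exists_isAtom_hvec_mem (H := H)
  choose! c hc0 hc using hB
  -- Within one ideal the two square roots multiply to its constant; for different ideals both sides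
  -- vanish.
  refine ⟨fun α => √(c (I α)), fun α => Real.sqrt_pos.2 (hc0 _ (hI α)), fun α β => ?_⟩
  rw [hc _ (hI α) _ (hmem α)]
  by_cases h : I α = I β
  · simp only [← h, Real.mul_self_sqrt (hc0 _ (hI α)).le]
  · rw [killingForm_eq_zero_of_isAtom (hI α) (hI β) h (hmem α) (hmem β)]
    simp

/-- The trace of ad h_α ∘ ad h_β is taken over the root spaces, where the eigenvalues γ(h_α) are
integers. -/
lemma killingForm_hvec (α β : H.root) :
    killingForm ℂ g (hvec α) (hvec β) =
      ((∑ γ : H.root, ((rootSystem H).pairingIn ℤ γ α : ℝ) * (rootSystem H).pairingIn ℤ γ β : ℝ) :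
        ℂ) := by
  have h : ((killingForm ℂ g).restrict H) ((rootSystem H).coroot α) ((rootSystem H).coroot β) =
    (rootSystem H).CorootForm ((rootSystem H).coroot α) ((rootSystem H).coroot β) := by
    rw [corootForm_rootSystem_eq_killing]
  have h2 : killingForm ℂ g (hvec α) (hvec β) =
    (rootSystem H).CorootForm ((rootSystem H).coroot α) ((rootSystem H).coroot β) := h
  rw [h2, RootPairing.CorootForm, RootPairing.RootForm, LinearMap.sum_apply, LinearMap.sum_apply]
  push_cast
  refine Finset.sum_congr rfl fun γ _ => ?_
  have (α : H.root) : (rootSystem H).root' γ ((rootSystem H).coroot α) =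
    ((rootSystem H).pairingIn ℤ γ α : ℂ) :=
    ((rootSystem H).algebraMap_pairingIn ℤ γ α).symm
  exact congrArg₂ (· * ·) (this α) (this β)

/-- This exhibits the Gram matrix of the coroots as that of the real vectors (s_α γ(h_α))_γ, from
which both signs needed later follow. -/
lemma re_admissible_hvec {B : LinearMap.BilinForm ℂ g} (hB : IsAdmissibleForm B) :
    ∃ s : H.root → ℝ, (∀ α, 0 < s α) ∧ ∀ α β : H.root,
      (B (hvec α) (hvec β)).re = ∑ γ : H.root, (s α * (rootSystem H).pairingIn ℤ γ α) *
        (s β * (rootSystem H).pairingIn ℤ γ β) := by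
  obtain ⟨s, hs, h⟩ := hB.exists_scaling (H := H)
  refine ⟨s, hs, fun α β => ?_⟩
  rw [h, killingForm_hvec, ← Complex.ofReal_mul, Complex.ofReal_re, Finset.mul_sum]
  exact Finset.sum_congr rfl fun γ _ => by ring

lemma modelCoeffs_normSq_pos {B : LinearMap.BilinForm ℂ g} (hB : IsAdmissibleForm B) (W₀ : H)
    (i : sigmaW W₀) : 0 < (modelCoeffs B W₀).normSq i := by
  obtain ⟨s, hs, h⟩ := re_admissible_hvec (H := H) hB
  change 0 < 4 / (B (hvec i.1) (hvec i.1)).re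
  rw [h]
  apply div_pos (by norm_num)
  refine Finset.sum_pos' (fun γ _ => mul_self_nonneg _) ⟨i.1, Finset.mem_univ _, ?_⟩
  rw [RootPairing.pairingIn_same]
  have := hs i.1
  positivity

lemma modelCoeffs_h_nonneg {B : LinearMap.BilinForm ℂ g} (hB : IsAdmissibleForm B) (W₀ : H)
    (x : sigmaW W₀ → ℝ) : 0 ≤ ∑ i, ∑ j, x i * (modelCoeffs B W₀).h i j * x j := by
  obtain ⟨s, hs, h⟩ := re_admissible_hvec (H := H) hB
  have : ∑ i, ∑ j, x i * (modelCoeffs B W₀).h i j * x j =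
      ∑ γ : H.root, (∑ i : sigmaW W₀, x i * (s i.1 * (rootSystem H).pairingIn ℤ γ i.1)) *
        (∑ i : sigmaW W₀, x i * (s i.1 * (rootSystem H).pairingIn ℤ γ i.1)) := by
    simp only [modelCoeffs, Matrix.of_apply, h, Finset.mul_sum, Finset.sum_mul]
    rw [Finset.sum_comm' (t' := Finset.univ) (s' := fun _ => Finset.univ) (by simp)]
    rw [Finset.sum_comm]
    conv_rhs => rw [Finset.sum_comm]
    refine Finset.sum_congr rfl fun i _ => ?_
    rw [Finset.sum_comm]
    refine Finset.sum_congr rfl fun j _ => Finset.sum_congr rfl fun γ _ => ?_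
    ring
  rw [this]
  exact Finset.sum_nonneg fun γ _ => mul_self_nonneg _

end LiePositivity

/-! ### Analytic flow of a polynomial vector field. -/

section PolynomialFlow

open Set MvPolynomial unitInterval
open scoped ContDiff

/-- Forward uniqueness for an autonomous equation with a `C¹` right-hand side. -/
lemma eqOn_Icc_of_hasDerivWithinAt {E : Type*} [NormedAddCommGroup E] [NormedSpace ℝ E]
    {f : E → E} (hf : ContDiff ℝ 1 f) {a b : ℝ} {y₁ y₂ : ℝ → E}
    (h₁ : ContinuousOn y₁ (Icc a b))
    (h₁' : ∀ t ∈ Ico a b, HasDerivWithinAt y₁ (f (y₁ t)) (Ici t) t)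
    (h₂ : ContinuousOn y₂ (Icc a b))
    (h₂' : ∀ t ∈ Ico a b, HasDerivWithinAt y₂ (f (y₂ t)) (Ici t) t)
    (h : y₁ a = y₂ a) : EqOn y₁ y₂ (Icc a b) := by
  have hc : IsCompact (y₁ '' Icc a b ∪ y₂ '' Icc a b) :=
    (isCompact_Icc.image_of_continuousOn h₁).union (isCompact_Icc.image_of_continuousOn h₂)
  obtain ⟨K, hK⟩ := hf.locallyLipschitz.locallyLipschitzOn.exists_lipschitzOnWith_of_compact hc
  exact ODE_solution_unique_of_mem_Icc_right (v := fun _ => f) (fun _ _ => hK) h₁ h₁'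
    (fun t ht => Or.inl (mem_image_of_mem _ (Ico_subset_Icc_self ht))) h₂ h₂'
    (fun t ht => Or.inr (mem_image_of_mem _ (Ico_subset_Icc_self ht))) h

/-- The primitive of a continuous function on the unit interval that vanishes at `0`. -/
noncomputable def primitiveCLM : C(I, ℝ) →L[ℝ] C(I, ℝ) :=
  LinearMap.mkContinuous
    { toFun := fun f => ⟨fun t => ∫ τ in (0 : ℝ)..t, IccExtend zero_le_one f τ, by
        refine Continuous.comp (g := fun t : ℝ => ∫ τ in (0 : ℝ)..t, IccExtend zero_le_one f τ)
          ?_ continuous_subtype_val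
        exact intervalIntegral.continuous_primitive
          (fun _ _ => (f.continuous.Icc_extend').intervalIntegrable _ _) 0⟩
      map_add' := fun f g => by
        ext t
        exact intervalIntegral.integral_add ((f.continuous.Icc_extend').intervalIntegrable _ _)
          ((g.continuous.Icc_extend').intervalIntegrable _ _)
      map_smul' := fun c f => by
        ext t
        exact intervalIntegral.integral_const_mul c _ } 1 fun f => by
    rw [one_mul, ContinuousMap.norm_le _ (norm_nonneg f)]
    intro t
    refine (intervalIntegral.norm_integral_le_of_norm_le_const (C := ‖f‖)
      fun τ _ => f.norm_coe_le_norm _).trans ?_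
    rw [sub_zero, abs_of_nonneg t.2.1]
    exact mul_le_of_le_one_right (norm_nonneg f) t.2.2

lemma primitiveCLM_apply (f : C(I, ℝ)) (t : I) :
    primitiveCLM f t = ∫ τ in (0 : ℝ)..t, IccExtend zero_le_one f τ := rfl

lemma aeval_continuousMap_apply {κ : Type*} (u : κ → C(I, ℝ)) (q : MvPolynomial κ ℝ) (t : I) :
    aeval u q t = eval (fun j => u j t) q := by
  induction q using MvPolynomial.induction_on with
  | C a => simp
  | add p q hp hq => simp [hp, hq]
  | mul_X p j hp => simp [hp]

variable {κ : Type*} (p : κ → MvPolynomial κ ℝ)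

/-- The zeros `((s, c), u)` of this map are the solutions of `u' = s p(u)`, `u(0) = c` on the unit
interval. -/
noncomputable def flowMap (x : (ℝ × (κ → ℝ)) × (κ → C(I, ℝ))) (j : κ) : C(I, ℝ) :=
  x.2 j - algebraMap ℝ C(I, ℝ) (x.1.2 j) - x.1.1 • primitiveCLM (aeval x.2 (p j))

/-- Smoothness index `ω` means analytic. The map is composed of continuous linear maps, a scalar
multiplication and a polynomial in the Banach algebra C([0,1]). -/
lemma contDiffAt_flowMap [Fintype κ] (x : (ℝ × (κ → ℝ)) × (κ → C(I, ℝ))) : ContDiffAt ℝ ω (flowMap p) x := by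
  refine contDiffAt_pi.2 fun j => AnalyticAt.contDiffAt ?_
  have h2 (i : κ) : AnalyticAt ℝ (fun x : (ℝ × (κ → ℝ)) × (κ → C(I, ℝ)) => x.2 i) x :=
    ((ContinuousLinearMap.proj (R := ℝ) (φ := fun _ : κ => C(I, ℝ)) i).comp
      (ContinuousLinearMap.snd ℝ (ℝ × (κ → ℝ)) (κ → C(I, ℝ)))).analyticAt x
  have hs : AnalyticAt ℝ (fun x : (ℝ × (κ → ℝ)) × (κ → C(I, ℝ)) => x.1.1) x :=
    ((ContinuousLinearMap.fst ℝ ℝ (κ → ℝ)).comp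
      (ContinuousLinearMap.fst ℝ (ℝ × (κ → ℝ)) (κ → C(I, ℝ)))).analyticAt x
  have hc : AnalyticAt ℝ
      (fun x : (ℝ × (κ → ℝ)) × (κ → C(I, ℝ)) => algebraMap ℝ C(I, ℝ) (x.1.2 j)) x :=
    ((algebraMapCLM ℝ C(I, ℝ)).comp
      ((ContinuousLinearMap.proj (R := ℝ) (φ := fun _ : κ => ℝ) j).comp
        ((ContinuousLinearMap.snd ℝ ℝ (κ → ℝ)).comp
      (ContinuousLinearMap.fst ℝ (ℝ × (κ → ℝ)) (κ → C(I, ℝ)))))).analyticAt x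
  have hp : AnalyticAt ℝ
      (fun x : (ℝ × (κ → ℝ)) × (κ → C(I, ℝ)) => primitiveCLM (aeval x.2 (p j))) x :=
    (primitiveCLM.analyticAt _).comp (AnalyticAt.aeval_mvPolynomial h2 (p j))
  exact ((h2 j).sub hc).sub (hs.smul hp)

/-- Zeros of `flowMap` are integral curves. -/
lemma exists_curve_of_flowMap_eq_zero {s : ℝ} {c : κ → ℝ} {u : κ → C(I, ℝ)}
    (h : flowMap p ((s, c), u) = 0) :
    ∃ W : ℝ → κ → ℝ, W 0 = c ∧ (∀ j, W 1 j = u j 1) ∧ Continuous W ∧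
      ∀ t ∈ Icc (0 : ℝ) 1, HasDerivAt W (fun j => s * eval (W t) (p j)) t := by
  -- Extending the integrand by constants outside the interval gives two-sided derivatives also at
  -- the endpoints.
  set W : ℝ → κ → ℝ := fun t j =>
    c j + s * ∫ τ in (0 : ℝ)..t, IccExtend zero_le_one (aeval u (p j)) τ with hW
  have hWu : ∀ (t : I) (j : κ), W t j = u j t := by
    intro t j
    have := DFunLike.congr_fun (congrFun h j) t
    simp only [flowMap, ContinuousMap.sub_apply, ContinuousMap.smul_apply, primitiveCLM_apply,
      smul_eq_mul, Pi.zero_apply, ContinuousMap.zero_apply] at this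
    have hc : algebraMap ℝ C(I, ℝ) (c j) t = c j := by simp
    rw [hc] at this
    simp only [hW]
    linarith
  have hd : ∀ t j, HasDerivAt (fun t => W t j)
      (s * IccExtend zero_le_one (aeval u (p j)) t) t := by
    intro t j
    have hc : Continuous (IccExtend zero_le_one (aeval u (p j))) :=
      (ContinuousMap.continuous (aeval u (p j))).Icc_extend'
    exact ((intervalIntegral.integral_hasDerivAt_right (hc.intervalIntegrable _ _)
      hc.aestronglyMeasurable.stronglyMeasurableAtFilter hc.continuousAt).const_mul s).const_add _
  refine ⟨W, by simp [hW], fun j => hWu 1 j, ?_, fun t ht => ?_⟩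
  · exact continuous_pi fun j => continuous_iff_continuousAt.2 fun t => (hd t j).continuousAt
  · refine hasDerivAt_pi.2 fun j => ?_
    have := hd t j
    rw [IccExtend_of_mem _ _ ht, aeval_continuousMap_apply] at this
    simp only [← hWu] at this
    exact this

variable [Fintype κ]

lemma contDiff_eval_mvPolynomial (a : ℝ) :
    ContDiff ℝ 1 (fun y : κ → ℝ => fun j => a * eval y (p j)) := by
  refine contDiff_pi.2 fun j => contDiff_const.mul ?_
  have := (AnalyticOnNhd.eval_mvPolynomial (𝕜 := ℝ) (p j))
  exact contDiff_iff_contDiffAt.2 fun x => (this x (mem_univ _)).contDiffAt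

/-- The local flow of a polynomial vector field is jointly analytic in time and initial value. -/
theorem exists_analyticAt_flow (c₀ : κ → ℝ) :
    ∃ y : ℝ × (κ → ℝ) → κ → ℝ, AnalyticAt ℝ y (0, c₀) ∧
      ∃ δ > 0, ∀ᶠ c in 𝓝 c₀, y (0, c) = c ∧
        ∀ z ∈ Ioo 0 δ, HasDerivAt (fun z => y (z, c)) (fun j => eval (y (z, c)) (p j)) z := by
  -- The rescaling u(t) = y(st) turns time s into a parameter of an equation on a fixed interval, so
  -- the implicit function theorem yields joint analyticity in s and c. At s = 0 the map is u - u₀,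
  -- with derivative the identity.
  set u₀ : κ → C(I, ℝ) := fun j => algebraMap ℝ C(I, ℝ) (c₀ j)
  have hcd := contDiffAt_flowMap p ((0, c₀), u₀)
  have h0 : flowMap p ((0, c₀), u₀) = 0 := by
    ext j t
    simp [flowMap, u₀]
  have hinv : (fderiv ℝ (flowMap p) ((0, c₀), u₀) ∘L .inr ℝ (ℝ × (κ → ℝ)) (κ → C(I, ℝ))) =
      ContinuousLinearMap.id ℝ _ := by
    have h1 := (hcd.differentiableAt (by simp)).hasFDerivAt.comp u₀
      (hasFDerivAt_prodMk_right ((0, c₀) : ℝ × (κ → ℝ)) u₀)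
    have h2 : (flowMap p ∘ fun u => (((0, c₀) : ℝ × (κ → ℝ)), u)) = fun u => u - u₀ := by
      ext u j t
      simp [flowMap, u₀]
    rw [h2] at h1
    exact h1.unique ((hasFDerivAt_id u₀).sub_const u₀)
  have if₂ : (fderiv ℝ (flowMap p) ((0, c₀), u₀) ∘L
      .inr ℝ (ℝ × (κ → ℝ)) (κ → C(I, ℝ))).IsInvertible := by
    rw [hinv]
    exact ⟨ContinuousLinearEquiv.refl ℝ _, rfl⟩
  have hne : (ω : WithTop ℕ∞) ≠ 0 := by simp
  set U := hcd.implicitFunction hne if₂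
  have hU : AnalyticAt ℝ U (0, c₀) :=
    (hcd.contDiffAt_implicitFunction hne if₂).analyticAt
  have hev : ∀ᶠ x in 𝓝 ((0, c₀) : ℝ × (κ → ℝ)), flowMap p (x, U x) = 0 := by
    have := hcd.eventually_apply_implicitFunction hne if₂
    rwa [h0] at this
  -- Undoing the rescaling, the flow at time s is the endpoint u(1).
  refine ⟨fun x j => U x j 1, ?_, ?_⟩
  · exact (ContinuousLinearMap.analyticAt (ContinuousLinearMap.pi fun j =>
      (ContinuousMap.evalCLM ℝ (1 : I)).comp
        (ContinuousLinearMap.proj (R := ℝ) (φ := fun _ : κ => C(I, ℝ)) j)) _).comp hU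
  · rw [nhds_prod_eq] at hev
    obtain ⟨P, hP, Q, hQ, hPQ⟩ := eventually_prod_iff.1 hev
    obtain ⟨δ, hδ, hball⟩ := Metric.eventually_nhds_iff.1 hP
    refine ⟨δ, hδ, hQ.mono fun c hc => ⟨?_, fun z hz => ?_⟩⟩
    · obtain ⟨W, hW0, hW1, -, hWd⟩ := exists_curve_of_flowMap_eq_zero p
        (hPQ (hball (show dist (0 : ℝ) 0 < δ by simpa using hδ)) hc)
      ext j
      change U (0, c) j 1 = c j
      rw [← hW1, ← hW0]
      have := eqOn_Icc_of_hasDerivWithinAt (contDiff_eval_mvPolynomial p 0) (a := 0) (b := 1)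
        (y₁ := W) (y₂ := fun _ => W 0)
        (fun t ht => (hWd t ht).continuousAt.continuousWithinAt)
        (fun t ht => (hWd t (Ico_subset_Icc_self ht)).hasDerivWithinAt) continuousOn_const
        (fun t _ => by
          have := hasDerivWithinAt_const t (Ici t) (W 0)
          convert this using 1
          ext j
          simp) rfl
      rw [this (right_mem_Icc.2 zero_le_one)]
    -- A single curve W with parameter s > z covers a neighbourhood of z: by uniqueness the curve
    -- with parameter x < s is t ↦ W(tx/s), so the flow at time x is W(x/s).
    · obtain ⟨s, hzs, hsδ⟩ := exists_between hz.2
      have hs : 0 < s := hz.1.trans hzs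
      have hmem : ∀ x : ℝ, 0 < x → x < δ → dist x 0 < δ := fun x h1 h2 => by
        rwa [Real.dist_eq, sub_zero, abs_of_pos h1]
      obtain ⟨W, hW0, hW1, hWc, hWd⟩ := exists_curve_of_flowMap_eq_zero p
        (hPQ (hball (hmem s hs hsδ)) hc)
      have key : ∀ x ∈ Ioo 0 s, (fun j => U (x, c) j 1) = W (x / s) := by
        intro x hx
        obtain ⟨V, hV0, hV1, hVc, hVd⟩ := exists_curve_of_flowMap_eq_zero p
          (hPQ (hball (hmem x hx.1 (hx.2.trans hsδ))) hc)
        have hxs : x / s ≤ 1 := (div_le_one hs).2 hx.2.le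
        have := eqOn_Icc_of_hasDerivWithinAt (contDiff_eval_mvPolynomial p x) (a := 0) (b := 1)
          (y₁ := V) (y₂ := fun t => W (x / s * t)) hVc.continuousOn
          (fun t ht => (hVd t (Ico_subset_Icc_self ht)).hasDerivWithinAt)
          (by fun_prop) (fun t ht => by
            have hd := hWd (x / s * t) ⟨mul_nonneg (div_pos hx.1 hs).le ht.1,
              mul_le_one₀ hxs ht.1 ht.2.le⟩
            have := hd.scomp t ((hasDerivAt_id t).const_mul (x / s))
            refine (this.congr_deriv ?_).hasDerivWithinAt
            ext j
            change x / s * 1 * (s * eval (W (x / s * t)) (p j)) = x * eval (W (x / s * t)) (p j)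
            field_simp) (by simp [hV0, hW0])
        have h1 := this (right_mem_Icc.2 zero_le_one)
        simp only [mul_one] at h1
        rw [← h1]
        exact funext fun j => (hV1 j).symm
      have hd := (hWd (z / s) ⟨(div_pos hz.1 hs).le, (div_le_one hs).2 hzs.le⟩).scomp z
        ((hasDerivAt_id z).div_const s)
      have hd' : HasDerivAt (fun x => W (x / s)) (fun j => eval (W (z / s)) (p j)) z := by
        refine hd.congr_deriv ?_
        ext j
        change 1 / s * (s * eval (W (z / s)) (p j)) = eval (W (z / s)) (p j)
        field_simp
      rw [← key z ⟨hz.1, hzs⟩] at hd'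
      refine hd'.congr_of_eventuallyEq ?_
      filter_upwards [Ioo_mem_nhds hz.1 hzs] with x hx using key x hx

end PolynomialFlow

/-! ### The regularized system and its equivalence with the field equations. -/

/-- The unknowns of the equations regularized at `z = r⁻¹ = 0`: besides `z` and the field variables
these are `T = S⁻¹`, `q = (z² μ)⁻¹` and the `z`-derivatives `v_i`, `e_i` of `ω_i`, `E_i`. -/
inductive Var (ι : Type*)
  | z | m | S | T | q
  | ω (i : ι) | v (i : ι) | E (i : ι) | e (i : ι)
  deriving Fintype

namespace Regularized

noncomputable section

set_option linter.unusedSectionVars false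

variable {ι : Type*} [Fintype ι] [DecidableEq ι] {A : Type*} [CommRing A] [Algebra ℝ A]
  (K : Coeffs ι) (k ℓ : ℝ) (y : Var ι → A)

/-- `λ = z² μ`. -/
def lam : A := algebraMap ℝ A (ℓ ^ 2)⁻¹ + k • y .z ^ 2 - 2 * y .m * y .z ^ 3

/-- `k w_j - ω_j²`. -/
def defect (j : ι) : A := algebraMap ℝ A (k * K.w j) - y (.ω j) ^ 2

/-- The `z`-derivative of `a_i`. -/
def aDot (i : ι) : A := ∑ j, K.C⁻¹ i j • y (.e j)

/-- `z⁻⁴ η`. -/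
def eta : A := (1 / 2 : ℝ) • ∑ i, ∑ j, K.h i j • (aDot K y i * aDot K y j)

/-- `ζ`. -/
def zeta : A := ∑ i, (K.normSq i)⁻¹ • (y (.E i) ^ 2 * y (.ω i) ^ 2)

/-- `z⁻⁴ G`. -/
def gee : A := ∑ i, (K.normSq i)⁻¹ • y (.v i) ^ 2

/-- `P`. -/
def pee : A := (1 / 8 : ℝ) • ∑ i, ∑ j, K.h i j • (defect K k y i * defect K k y j)

/-- `F_i`. -/
def eff (i : ι) : A := y (.ω i) * ∑ j, (K.C i j / 2) • defect K k y j

/-- `Z_i`. -/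
def zed (i : ι) : A := ∑ j, K.C i j • (y (.E j) * y (.ω j) ^ 2)

/-- `z⁻⁴ (G + ζ / (μ² S²))`. -/
def friction : A := gee K y + zeta K y * y .q ^ 2 * y .T ^ 2

/-- The `z`-derivative of `m`. -/
def mDot : A :=
  -(eta K y * y .T ^ 2 + zeta K y * y .q * y .T ^ 2 + lam k ℓ y * gee K y + pee K k y)

/-- The `z`-derivative of `λ`. -/
def lamDot : A :=
  2 * (k • y .z) - 6 * y .m * y .z ^ 2 - 2 * mDot K k ℓ y * y .z ^ 3

/-- The right-hand side of the field equations, regularized at `z = 0`. -/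
def vectorField : Var ι → A
  | .z => 1
  | .m => mDot K k ℓ y
  | .S => -(2 * y .z ^ 3 * friction K y * y .S)
  | .T => 2 * y .z ^ 3 * friction K y * y .T
  | .q => -(y .q ^ 2 * lamDot K k ℓ y)
  | .ω i => y (.v i)
  | .v i => -(y .q * (2 * y (.v i) * (k • y .z - 3 * y .m * y .z ^ 2 + pee K k y * y .z ^ 3
      + y .z ^ 3 * eta K y * y .T ^ 2)
      + y (.E i) ^ 2 * y (.ω i) * y .q * y .T ^ 2 + eff K k y i))
  | .E i => y (.e i)
  | .e i => zed K y i * y .q - 2 * y .z ^ 3 * friction K y * y (.e i)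

/-- The formulas make sense in any commutative real algebra. This identifies their polynomial
version, used for the flow, with the real version, used for the equations. -/
lemma eval_vectorField (y : Var ι → ℝ) (j : Var ι) :
    MvPolynomial.eval y (vectorField K k ℓ (MvPolynomial.X : Var ι → MvPolynomial (Var ι) ℝ) j) =
      vectorField K k ℓ y j := by
  cases j <;>
  simp only [vectorField, mDot, lamDot, friction, zed, eff, pee, gee, zeta, eta, aDot, defect, lam,
    map_add, map_sub, map_mul, map_neg, map_pow, map_sum, map_one, map_ofNat,
    MvPolynomial.smul_eval, MvPolynomial.algebraMap_eq, MvPolynomial.eval_C, MvPolynomial.eval_X,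
    smul_eq_mul, Algebra.algebraMap_self, RingHom.id_apply]

lemma contDiff_vectorField : ContDiff ℝ 1 (vectorField K k ℓ : (Var ι → ℝ) → Var ι → ℝ) := by
  have := contDiff_eval_mvPolynomial
    (vectorField K k ℓ (MvPolynomial.X : Var ι → MvPolynomial (Var ι) ℝ)) 1
  simp only [one_mul, eval_vectorField] at this
  exact this

/-- The regularized unknowns of a set of field variables. -/
def state (Φ : Fields ι) (z : ℝ) : Var ι → ℝ
  | .z => z
  | .m => Φ.m z⁻¹
  | .S => Φ.S z⁻¹
  | .T => (Φ.S z⁻¹)⁻¹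
  | .q => ((ℓ ^ 2)⁻¹ + k * z ^ 2 - 2 * Φ.m z⁻¹ * z ^ 3)⁻¹
  | .ω i => Φ.ω i z⁻¹
  | .v i => -(z ^ 2)⁻¹ * deriv (Φ.ω i) z⁻¹
  | .E i => Φ.E i z⁻¹
  | .e i => -(z ^ 2)⁻¹ * deriv (Φ.E i) z⁻¹

/-- The regularized unknowns at `z = 0` with given data at infinity. -/
def initial (c : DataAtInfinity ι) : Var ι → ℝ
  | .z => 0
  | .m => c.1
  | .S => 1
  | .T => 1
  | .q => ℓ ^ 2
  | .ω i => c.2.1 i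
  | .v i => c.2.2.1 i
  | .E i => c.2.2.2.1 i
  | .e i => c.2.2.2.2 i

section Translation

variable {Φ : Fields ι} {z : ℝ}

lemma mu_eq (hz : z ≠ 0) (hℓ : ℓ ≠ 0) :
    Coeffs.mu k ℓ Φ z⁻¹ = lam k ℓ (state k ℓ Φ z) / z ^ 2 := by
  simp only [Coeffs.mu, lam, state, smul_eq_mul, Algebra.algebraMap_self, RingHom.id_apply]
  field_simp
  ring

lemma eta_eq (hz : z ≠ 0) : K.eta Φ z⁻¹ = z ^ 4 * eta K (state k ℓ Φ z) := by
  have (i : ι) : K.aDeriv Φ z⁻¹ i = -z ^ 2 * aDot K (state k ℓ Φ z) i := by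
    simp only [Coeffs.aDeriv, aDot, state, smul_eq_mul, Finset.mul_sum]
    refine Finset.sum_congr rfl fun j _ => ?_
    field_simp
  simp only [Coeffs.eta, eta, this, smul_eq_mul, Finset.mul_sum]
  refine Finset.sum_congr rfl fun i _ => Finset.sum_congr rfl fun j _ => ?_
  ring

lemma zeta_eq : K.zeta Φ z⁻¹ = zeta K (state k ℓ Φ z) := by
  simp only [Coeffs.zeta, zeta, state, smul_eq_mul]
  exact Finset.sum_congr rfl fun i _ => by rw [div_eq_inv_mul]

lemma G_eq (hz : z ≠ 0) : K.G Φ z⁻¹ = z ^ 4 * gee K (state k ℓ Φ z) := by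
  simp only [Coeffs.G, gee, state, smul_eq_mul, Finset.mul_sum]
  refine Finset.sum_congr rfl fun i _ => ?_
  rw [div_eq_inv_mul]
  field_simp

lemma P_eq : K.P k Φ z⁻¹ = pee K k (state k ℓ Φ z) := by
  simp only [Coeffs.P, pee, Coeffs.defect, defect, state, smul_eq_mul, Algebra.algebraMap_self,
    RingHom.id_apply]
  congr 1
  exact Finset.sum_congr rfl fun i _ => Finset.sum_congr rfl fun j _ => by ring

lemma F_eq (i : ι) : K.F k Φ z⁻¹ i = eff K k (state k ℓ Φ z) i := by
  simp only [Coeffs.F, eff, Coeffs.defect, defect, state, smul_eq_mul, Algebra.algebraMap_self,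
    RingHom.id_apply, Finset.mul_sum]
  exact Finset.sum_congr rfl fun j _ => by ring

lemma Z_eq (i : ι) : K.Z Φ z⁻¹ i = zed K (state k ℓ Φ z) i := by
  simp only [Coeffs.Z, zed, state, smul_eq_mul]
  exact Finset.sum_congr rfl fun j _ => by ring

lemma state_q : state k ℓ Φ z .q = (lam k ℓ (state k ℓ Φ z))⁻¹ := by
  simp [lam, state]

lemma deriv_ω_eq (hz : z ≠ 0) (i : ι) :
    deriv (Φ.ω i) z⁻¹ = -z ^ 2 * state k ℓ Φ z (.v i) := by
  simp only [state]
  field_simp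

lemma deriv_E_eq (hz : z ≠ 0) (i : ι) :
    deriv (Φ.E i) z⁻¹ = -z ^ 2 * state k ℓ Φ z (.e i) := by
  simp only [state]
  field_simp

variable (hz : z ≠ 0) (hℓ : ℓ ≠ 0) (hlam : lam k ℓ (state k ℓ Φ z) ≠ 0)

include hz hℓ hlam

/-- The factor `-z ^ 2` is dz/dr. -/
lemma einstein_m_rhs_eq :
    z⁻¹ ^ 2 * K.eta Φ z⁻¹ / Φ.S z⁻¹ ^ 2
      + K.zeta Φ z⁻¹ / (Coeffs.mu k ℓ Φ z⁻¹ * Φ.S z⁻¹ ^ 2)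
      + Coeffs.mu k ℓ Φ z⁻¹ * K.G Φ z⁻¹ + K.P k Φ z⁻¹ / z⁻¹ ^ 2 =
    -z ^ 2 * vectorField K k ℓ (state k ℓ Φ z) .m := by
  simp only [vectorField, mDot]
  rw [eta_eq K k ℓ hz, zeta_eq K k ℓ, mu_eq k ℓ hz hℓ, G_eq K k ℓ hz, P_eq K k ℓ, state_q]
  generalize eta K (state k ℓ Φ z) = η
  generalize zeta K (state k ℓ Φ z) = ζ
  generalize gee K (state k ℓ Φ z) = γ
  generalize pee K k (state k ℓ Φ z) = p
  generalize lam k ℓ (state k ℓ Φ z) = L at hlam ⊢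
  simp only [state]
  field_simp

lemma einstein_S_rhs_eq (hS : Φ.S z⁻¹ ≠ 0) :
    2 * K.G Φ z⁻¹ / z⁻¹
      + 2 * K.zeta Φ z⁻¹ / (Coeffs.mu k ℓ Φ z⁻¹ ^ 2 * Φ.S z⁻¹ ^ 2 * z⁻¹) =
    -z ^ 2 * vectorField K k ℓ (state k ℓ Φ z) .S / Φ.S z⁻¹ := by
  simp only [vectorField, friction]
  rw [zeta_eq K k ℓ, mu_eq k ℓ hz hℓ, G_eq K k ℓ hz, state_q]
  generalize zeta K (state k ℓ Φ z) = ζ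
  generalize gee K (state k ℓ Φ z) = γ
  generalize lam k ℓ (state k ℓ Φ z) = L at hlam ⊢
  simp only [state]
  generalize Φ.S z⁻¹ = s at hS ⊢
  field_simp

/-- `X` stands for de/dz, so that z⁴X + 2z³e is E''. Leaving it free lets the identity serve in both
directions between solutions and integral curves. The term 2E'/r cancels 2z³e. -/
lemma ym_E_eq (i : ι) (X : ℝ) :
    (z ^ 4 * X + 2 * z ^ 3 * state k ℓ Φ z (.e i))
      + 2 / z⁻¹ * (1 - K.G Φ z⁻¹
          - K.zeta Φ z⁻¹ / (Coeffs.mu k ℓ Φ z⁻¹ ^ 2 * Φ.S z⁻¹ ^ 2)) * deriv (Φ.E i) z⁻¹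
      - K.Z Φ z⁻¹ i / (Coeffs.mu k ℓ Φ z⁻¹ * z⁻¹ ^ 2) =
    z ^ 4 * (X - vectorField K k ℓ (state k ℓ Φ z) (.e i)) := by
  simp only [vectorField, friction]
  rw [zeta_eq K k ℓ, mu_eq k ℓ hz hℓ, G_eq K k ℓ hz, Z_eq K k ℓ, deriv_E_eq k ℓ hz, state_q]
  generalize zeta K (state k ℓ Φ z) = ζ
  generalize gee K (state k ℓ Φ z) = γ
  generalize zed K (state k ℓ Φ z) i = p
  generalize lam k ℓ (state k ℓ Φ z) = L at hlam ⊢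
  generalize state k ℓ Φ z (.e i) = e
  simp only [state]
  field_simp
  ring

/-- Here `X` stands for dv/dz. -/
lemma ym_ω_eq (i : ι) (X : ℝ) :
    z⁻¹ ^ 2 * Coeffs.mu k ℓ Φ z⁻¹ * (z ^ 4 * X + 2 * z ^ 3 * state k ℓ Φ z (.v i))
      + 2 * (Φ.m z⁻¹ - K.P k Φ z⁻¹ / z⁻¹ - z⁻¹ ^ 3 * K.eta Φ z⁻¹ / Φ.S z⁻¹ ^ 2
          + z⁻¹ ^ 3 / ℓ ^ 2) * deriv (Φ.ω i) z⁻¹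
      + z⁻¹ ^ 2 * Φ.E i z⁻¹ ^ 2 * Φ.ω i z⁻¹ / (Coeffs.mu k ℓ Φ z⁻¹ * Φ.S z⁻¹ ^ 2)
      + K.F k Φ z⁻¹ i =
    lam k ℓ (state k ℓ Φ z) * (X - vectorField K k ℓ (state k ℓ Φ z) (.v i)) := by
  -- The two terms of order 1/z, one from the change of variable and one from r³/ℓ², cancel; this is
  -- why z = 0 is a regular point.
  have hL : lam k ℓ (state k ℓ Φ z) / z - z⁻¹ / ℓ ^ 2 = k * z - 2 * Φ.m z⁻¹ * z ^ 2 := by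
    simp only [lam, state, smul_eq_mul, Algebra.algebraMap_self, RingHom.id_apply]
    field_simp
    ring
  simp only [vectorField]
  rw [mu_eq k ℓ hz hℓ, eta_eq K k ℓ hz, P_eq K k ℓ, F_eq K k ℓ, deriv_ω_eq k ℓ hz, state_q]
  generalize eta K (state k ℓ Φ z) = η
  generalize pee K k (state k ℓ Φ z) = p
  generalize eff K k (state k ℓ Φ z) i = f
  generalize lam k ℓ (state k ℓ Φ z) = L at hlam hL ⊢
  generalize state k ℓ Φ z (.v i) = v
  simp only [state, smul_eq_mul]
  have h1 : L * (X - -(L⁻¹ * (2 * v * (k * z - 3 * Φ.m z⁻¹ * z ^ 2 + p * z ^ 3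
      + z ^ 3 * η * (Φ.S z⁻¹)⁻¹ ^ 2) + Φ.E i z⁻¹ ^ 2 * Φ.ω i z⁻¹ * L⁻¹ * (Φ.S z⁻¹)⁻¹ ^ 2 + f))) =
      L * X + (2 * v * (k * z - 3 * Φ.m z⁻¹ * z ^ 2 + p * z ^ 3
      + z ^ 3 * η * (Φ.S z⁻¹)⁻¹ ^ 2) + Φ.E i z⁻¹ ^ 2 * Φ.ω i z⁻¹ * L⁻¹ * (Φ.S z⁻¹)⁻¹ ^ 2 + f) := by
    field_simp
    ring
  rw [h1]
  have h2 : z⁻¹ ^ 2 * (L / z ^ 2) * (z ^ 4 * X + 2 * z ^ 3 * v) = L * X + 2 * v * (L / z) := by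
    field_simp
  have h3 : z⁻¹ ^ 2 * Φ.E i z⁻¹ ^ 2 * Φ.ω i z⁻¹ / (L / z ^ 2 * Φ.S z⁻¹ ^ 2) =
      Φ.E i z⁻¹ ^ 2 * Φ.ω i z⁻¹ * L⁻¹ * (Φ.S z⁻¹)⁻¹ ^ 2 := by
    field_simp
  have h4 : 2 * (Φ.m z⁻¹ - p / z⁻¹ - z⁻¹ ^ 3 * (z ^ 4 * η) / Φ.S z⁻¹ ^ 2 + z⁻¹ ^ 3 / ℓ ^ 2) *
      (-z ^ 2 * v) = 2 * v * (-(Φ.m z⁻¹ * z ^ 2) + p * z ^ 3 + z ^ 3 * η * (Φ.S z⁻¹)⁻¹ ^ 2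
        - z⁻¹ / ℓ ^ 2) := by
    field_simp
    ring
  rw [h2, h3, h4]
  linear_combination 2 * v * hL

end Translation

end

end Regularized

lemma hasDerivAt_comp_inv {f : ℝ → ℝ} {f' z : ℝ} (hz : z ≠ 0) (hf : HasDerivAt f f' z⁻¹) :
    HasDerivAt (fun x => f x⁻¹) (-(z ^ 2)⁻¹ * f') z := by
  rw [mul_comm]
  exact hf.comp z (hasDerivAt_inv hz)

namespace Regularized

noncomputable section

open Set

variable {ι : Type*} [Fintype ι] [DecidableEq ι] {K : Coeffs ι} {k ℓ : ℝ}

lemma lam_state_pos {R z : ℝ} {Φ : Fields ι} (hℓ : 0 < ℓ) (hR : 0 < R)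
    (hΦ : IsSolutionBeyond K k ℓ R Φ) (hz : z ∈ Ioo 0 R⁻¹) : 0 < lam k ℓ (state k ℓ Φ z) := by
  have h := hΦ.mu_pos z⁻¹ ((lt_inv_comm₀ hz.1 hR).1 hz.2)
  rw [mu_eq k ℓ hz.1.ne' hℓ.ne'] at h
  exact (div_pos_iff_of_pos_right (pow_pos hz.1 2)).1 h

lemma deriv_lam_eq {ι : Type*} {k ℓ : ℝ} {y : ℝ → Var ι → ℝ} {z m' : ℝ} (hz : ∀ᶠ x in 𝓝 z, y x .z = x)
    (hm : HasDerivAt (fun x => y x .m) m' z) :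
    HasDerivAt (fun x => lam k ℓ (y x)) (2 * (k * z) - 6 * y z .m * z ^ 2 - 2 * m' * z ^ 3) z := by
  have h1 : HasDerivAt (fun x => (ℓ ^ 2)⁻¹ + k * x ^ 2 - 2 * y x .m * x ^ 3)
      (2 * (k * z) - 6 * y z .m * z ^ 2 - 2 * m' * z ^ 3) z := by
    refine (((((hasDerivAt_id z).pow 2).const_mul k).const_add (ℓ ^ 2)⁻¹).sub
      ((hm.const_mul 2).mul ((hasDerivAt_id z).pow 3))).congr_deriv ?_
    simp
    ring
  refine h1.congr_of_eventuallyEq ?_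
  filter_upwards [hz] with x hx
  simp [lam, hx]

/-- Solutions of the field equations are integral curves of the regularized vector field. -/
lemma hasDerivAt_state {R z : ℝ} {Φ : Fields ι} (hℓ : 0 < ℓ) (hR : 0 < R)
    (hΦ : IsSolutionBeyond K k ℓ R Φ) (hz : z ∈ Ioo 0 R⁻¹) :
    HasDerivAt (state k ℓ Φ) (vectorField K k ℓ (state k ℓ Φ z)) z := by
  have hr : R < z⁻¹ := (lt_inv_comm₀ hz.1 hR).1 hz.2
  have hz0 : z ≠ 0 := hz.1.ne'
  have hS := (hΦ.S_pos _ hr).ne'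
  have hlam := (lam_state_pos hℓ hR hΦ hz).ne'
  have hm : HasDerivAt (fun x => state k ℓ Φ x .m) (vectorField K k ℓ (state k ℓ Φ z) .m) z := by
    refine (hasDerivAt_comp_inv hz0 (hΦ.diff_m _ hr).hasDerivAt).congr_deriv ?_
    rw [hΦ.einstein_m _ hr, einstein_m_rhs_eq K k ℓ hz0 hℓ.ne' hlam]
    field_simp
  have hS' : HasDerivAt (fun x => state k ℓ Φ x .S) (vectorField K k ℓ (state k ℓ Φ z) .S) z := by
    refine (hasDerivAt_comp_inv hz0 (hΦ.diff_S _ hr).hasDerivAt).congr_deriv ?_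
    have h := hΦ.einstein_S _ hr
    rw [einstein_S_rhs_eq K k ℓ hz0 hℓ.ne' hlam hS, div_left_inj' hS] at h
    rw [h]
    field_simp
  have hω (i : ι) : HasDerivAt (fun x => state k ℓ Φ x (.ω i)) (state k ℓ Φ z (.v i)) z :=
    hasDerivAt_comp_inv hz0 (hΦ.diff_ω i _ hr).hasDerivAt
  have hE (i : ι) : HasDerivAt (fun x => state k ℓ Φ x (.E i)) (state k ℓ Φ z (.e i)) z :=
    hasDerivAt_comp_inv hz0 (hΦ.diff_E i _ hr).hasDerivAt
  -- The derivative of v = -z⁻² f'(1/z), solved for f''.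
  have hsecond {f : ℝ → ℝ} (hf : DifferentiableAt ℝ (deriv f) z⁻¹) :
      ∃ X, HasDerivAt (fun x => -(x ^ 2)⁻¹ * deriv f x⁻¹) X z ∧
        deriv (deriv f) z⁻¹ = z ^ 4 * X + 2 * z ^ 3 * (-(z ^ 2)⁻¹ * deriv f z⁻¹) := by
    have h1 : HasDerivAt (fun x : ℝ => -(x ^ 2)⁻¹) (2 * (z ^ 3)⁻¹) z := by
      refine ((((hasDerivAt_id z).pow 2).inv (pow_ne_zero 2 hz0)).neg).congr_deriv ?_
      simp
      field_simp
    refine ⟨_, h1.mul (hasDerivAt_comp_inv hz0 hf.hasDerivAt), ?_⟩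
    field_simp
    ring
  rw [hasDerivAt_pi]
  intro j
  cases j with
  | z => exact hasDerivAt_id z
  | m => exact hm
  | S => exact hS'
  | T =>
    refine (hS'.inv hS).congr_deriv ?_
    simp only [vectorField]
    simp only [state]
    generalize Φ.S z⁻¹ = s at hS ⊢
    field_simp
  | q =>
    have h := (deriv_lam_eq (k := k) (ℓ := ℓ) (Eventually.of_forall fun x => rfl) hm).inv hlam
    have h2 : (fun x => state k ℓ Φ x .q) = fun x => (lam k ℓ (state k ℓ Φ x))⁻¹ :=
      funext fun x => state_q k ℓ
    rw [h2]
    refine h.congr_deriv ?_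
    change _ = -(state k ℓ Φ z .q ^ 2 * lamDot K k ℓ (state k ℓ Φ z))
    rw [state_q, inv_pow, inv_mul_eq_div, neg_div]
    rfl
  | ω i => exact hω i
  | E i => exact hE i
  | v i =>
    obtain ⟨X, hX, hXeq⟩ := hsecond (hΦ.diff_ω' i _ hr)
    have h := hΦ.ym_ω i _ hr
    rw [hXeq] at h
    have h2 := h.trans (ym_ω_eq K k ℓ hz0 hℓ.ne' hlam i X)
    have h3 := (mul_eq_zero.1 h2.symm).resolve_left hlam
    rw [← sub_eq_zero.1 h3]
    exact hX
  | e i =>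
    obtain ⟨X, hX, hXeq⟩ := hsecond (hΦ.diff_E' i _ hr)
    have h := hΦ.ym_E i _ hr
    rw [hXeq] at h
    have h2 := h.trans (ym_E_eq K k ℓ hz0 hℓ.ne' hlam i X)
    have h3 := (mul_eq_zero.1 h2.symm).resolve_left (pow_ne_zero 4 hz0)
    rw [← sub_eq_zero.1 h3]
    exact hX

/-- The field variables, as functions of `r = z⁻¹`, of a curve of regularized unknowns. -/
def fieldsOfCurve (y : ℝ → Var ι → ℝ) : Fields ι where
  m := fun r => y r⁻¹ .m
  S := fun r => y r⁻¹ .S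
  ω := fun i r => y r⁻¹ (.ω i)
  E := fun i r => y r⁻¹ (.E i)

section Curve

variable {y : ℝ → Var ι → ℝ} {δ : ℝ}
  (hy : ∀ z ∈ Ioo 0 δ, HasDerivAt y (vectorField K k ℓ (y z)) z)
  (hyz : ∀ z ∈ Ioo 0 δ, y z .z = z) (hyS : ∀ z ∈ Ioo 0 δ, 0 < y z .S)
  (hylam : ∀ z ∈ Ioo 0 δ, 0 < lam k ℓ (y z))
  (hyT : ∀ z ∈ Ioo 0 δ, y z .T * y z .S = 1)
  (hyq : ∀ z ∈ Ioo 0 δ, y z .q * lam k ℓ (y z) = 1)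

include hy in
lemma deriv_fieldsOfCurve {z : ℝ} (hz : z ∈ Ioo 0 δ) (j : Var ι) :
    HasDerivAt (fun r => y r⁻¹ j) (-z ^ 2 * vectorField K k ℓ (y z) j) z⁻¹ := by
  have h := hasDerivAt_pi.1 (hy z hz) j
  rw [← inv_inv z] at h
  refine (hasDerivAt_comp_inv (inv_ne_zero hz.1.ne') h).congr_deriv ?_
  simp

-- The constraints recover `T` and `q`; `v` and `e` are recovered because the curve has them as
-- derivatives of `ω` and `E`.
include hy hyz hyT hyq in
lemma state_fieldsOfCurve {z : ℝ} (hz : z ∈ Ioo 0 δ) : state k ℓ (fieldsOfCurve y) z = y z := by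
  have hz0 := hz.1.ne'
  funext j
  cases j with
  | z => exact (hyz z hz).symm
  | m => simp [state, fieldsOfCurve]
  | S => simp [state, fieldsOfCurve]
  | T =>
    simp only [state, fieldsOfCurve, inv_inv]
    exact (eq_inv_of_mul_eq_one_left (hyT z hz)).symm
  | q =>
    rw [eq_inv_of_mul_eq_one_left (hyq z hz)]
    simp [state, lam, fieldsOfCurve, hyz z hz]
  | ω i => simp [state, fieldsOfCurve]
  | E i => simp [state, fieldsOfCurve]
  | v i =>
    simp only [state, fieldsOfCurve]
    rw [(deriv_fieldsOfCurve hy hz (.ω i)).deriv]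
    simp only [vectorField]
    field_simp
  | e i =>
    simp only [state, fieldsOfCurve]
    rw [(deriv_fieldsOfCurve hy hz (.E i)).deriv]
    simp only [vectorField]
    field_simp

include hy in
lemma deriv_deriv_fieldsOfCurve {z : ℝ} (hz : z ∈ Ioo 0 δ) {j j' : Var ι}
    (hj : ∀ x, vectorField K k ℓ (y x) j = y x j') :
    HasDerivAt (deriv fun r => y r⁻¹ j)
      (z ^ 4 * vectorField K k ℓ (y z) j' + 2 * z ^ 3 * y z j') z⁻¹ := by
  have hev : (deriv fun r => y r⁻¹ j) =ᶠ[𝓝 z⁻¹] fun r => -(r⁻¹ ^ 2) * y r⁻¹ j' := by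
    have hc : Tendsto (fun r : ℝ => r⁻¹) (𝓝 z⁻¹) (𝓝 z) := by
      simpa using (continuousAt_inv₀ (inv_ne_zero hz.1.ne')).tendsto
    filter_upwards [hc (Ioo_mem_nhds hz.1 hz.2)] with r hr
    have := (deriv_fieldsOfCurve hy hr j).deriv
    rw [inv_inv, hj] at this
    rw [this]
  refine HasDerivAt.congr_of_eventuallyEq ?_ hev
  have h := hasDerivAt_pi.1 (hy z hz) j'
  have h2 : HasDerivAt (fun x => -(x ^ 2) * y x j')
      (-(2 * z * y z j' + z ^ 2 * vectorField K k ℓ (y z) j')) z := by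
    refine ((((hasDerivAt_id z).pow 2).neg).mul h).congr_deriv ?_
    simp
    ring
  rw [← inv_inv z] at h2
  refine (hasDerivAt_comp_inv (f := fun x => -(x ^ 2) * y x j') (inv_ne_zero hz.1.ne')
    h2).congr_deriv ?_
  simp
  ring

include hy hyz hyS hylam hyT hyq in
/-- Integral curves of the regularized vector field give solutions of the field equations. -/
lemma isSolutionBeyond_fieldsOfCurve (hℓ : 0 < ℓ) (hδ : 0 < δ) :
    IsSolutionBeyond K k ℓ δ⁻¹ (fieldsOfCurve y) := by
  have hr : ∀ r, δ⁻¹ < r → ∃ z ∈ Ioo 0 δ, r = z⁻¹ := fun r hr =>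
    ⟨r⁻¹, ⟨inv_pos.2 ((inv_pos.2 hδ).trans hr), inv_lt_of_inv_lt₀ hδ hr⟩, (inv_inv r).symm⟩
  have hst : ∀ z ∈ Ioo 0 δ, state k ℓ (fieldsOfCurve y) z = y z := fun z hz =>
    state_fieldsOfCurve hy hyz hyT hyq hz
  have hS : ∀ z ∈ Ioo 0 δ, (fieldsOfCurve y).S z⁻¹ ≠ 0 := fun z hz => by
    simpa [fieldsOfCurve] using (hyS z hz).ne'
  have hlam : ∀ z ∈ Ioo 0 δ, lam k ℓ (state k ℓ (fieldsOfCurve y) z) ≠ 0 := fun z hz => by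
    rw [hst z hz]
    exact (hylam z hz).ne'
  refine ⟨?_, ?_, ?_, ?_, ?_, ?_, ?_, ?_, ?_, ?_, ?_, ?_⟩
  · intro r hrr
    obtain ⟨z, hz, rfl⟩ := hr r hrr
    rw [mu_eq k ℓ hz.1.ne' hℓ.ne', hst z hz]
    exact div_pos (hylam z hz) (pow_pos hz.1 2)
  · intro r hrr
    obtain ⟨z, hz, rfl⟩ := hr r hrr
    simpa [fieldsOfCurve] using hyS z hz
  · intro r hrr
    obtain ⟨z, hz, rfl⟩ := hr r hrr
    exact (deriv_fieldsOfCurve hy hz .m).differentiableAt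
  · intro r hrr
    obtain ⟨z, hz, rfl⟩ := hr r hrr
    exact (deriv_fieldsOfCurve hy hz .S).differentiableAt
  · intro i r hrr
    obtain ⟨z, hz, rfl⟩ := hr r hrr
    exact (deriv_fieldsOfCurve hy hz (.ω i)).differentiableAt
  · intro i r hrr
    obtain ⟨z, hz, rfl⟩ := hr r hrr
    exact (deriv_fieldsOfCurve hy hz (.E i)).differentiableAt
  · intro i r hrr
    obtain ⟨z, hz, rfl⟩ := hr r hrr
    exact (deriv_deriv_fieldsOfCurve hy hz (j := .ω i) (fun _ => rfl)).differentiableAt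
  · intro i r hrr
    obtain ⟨z, hz, rfl⟩ := hr r hrr
    exact (deriv_deriv_fieldsOfCurve hy hz (j := .E i) (fun _ => rfl)).differentiableAt
  · intro r hrr
    obtain ⟨z, hz, rfl⟩ := hr r hrr
    rw [einstein_m_rhs_eq K k ℓ hz.1.ne' hℓ.ne' (hlam z hz), hst z hz]
    exact (deriv_fieldsOfCurve hy hz .m).deriv
  · intro r hrr
    obtain ⟨z, hz, rfl⟩ := hr r hrr
    rw [einstein_S_rhs_eq K k ℓ hz.1.ne' hℓ.ne' (hlam z hz) (hS z hz), hst z hz]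
    congr 1
    exact (deriv_fieldsOfCurve hy hz .S).deriv
  · intro i r hrr
    obtain ⟨z, hz, rfl⟩ := hr r hrr
    have h := ym_E_eq K k ℓ hz.1.ne' hℓ.ne' (hlam z hz) i (vectorField K k ℓ (y z) (.e i))
    have h2 : deriv (deriv ((fieldsOfCurve y).E i)) z⁻¹ = _ :=
      (deriv_deriv_fieldsOfCurve hy hz (j := .E i) (fun _ => rfl)).deriv
    rw [h2]
    rw [hst z hz, sub_self, mul_zero] at h
    exact h.symm
  · intro i r hrr
    obtain ⟨z, hz, rfl⟩ := hr r hrr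
    have h := ym_ω_eq K k ℓ hz.1.ne' hℓ.ne' (hlam z hz) i (vectorField K k ℓ (y z) (.v i))
    have h2 : deriv (deriv ((fieldsOfCurve y).ω i)) z⁻¹ = _ :=
      (deriv_deriv_fieldsOfCurve hy hz (j := .ω i) (fun _ => rfl)).deriv
    rw [h2]
    rw [hst z hz, sub_self, mul_zero] at h
    exact h.symm

end Curve

end

end Regularized

/-! ### One-variable calculus at the endpoint z = 0. -/

section Calculus

open Set

/-- At 0 the right derivative is the limit of the derivatives. Uniqueness of integral curves can
thus start at z = 0. -/
lemma hasDerivWithinAt_Ici_of_Ioo {E : Type*} [NormedAddCommGroup E] [NormedSpace ℝ E]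
    {y f : ℝ → E} {δ : ℝ} (hδ : 0 < δ) (hy : ∀ z ∈ Ioo 0 δ, HasDerivAt y (f z) z)
    (hc : ContinuousOn y (Ico 0 δ)) (hf : ContinuousWithinAt f (Ici 0) 0) :
    ∀ z ∈ Ico 0 δ, HasDerivWithinAt y (f z) (Ici z) z := by
  intro z hz
  rcases hz.1.eq_or_lt with rfl | h
  · refine hasDerivWithinAt_Ici_of_tendsto_deriv (s := Ioo 0 δ)
      (fun x hx => (hy x hx).differentiableAt.differentiableWithinAt)
      ((hc 0 ⟨le_rfl, hδ⟩).mono Ioo_subset_Ico_self) (Ioo_mem_nhdsGT hδ) ?_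
    refine (hf.mono Ioi_subset_Ici_self).tendsto.congr' ?_
    filter_upwards [Ioo_mem_nhdsGT hδ] with x hx using (hy x hx).deriv.symm
  · exact (hy z ⟨h, hz.2⟩).hasDerivWithinAt

/-- A solution of a linear equation on `[0, δ)` that starts at `0` vanishes. -/
lemma eq_zero_of_linear_deriv {X a : ℝ → ℝ} {δ : ℝ} (hc : ContinuousOn X (Ico 0 δ))
    (ha : ContinuousOn a (Ico 0 δ)) (hX : ∀ z ∈ Ioo 0 δ, HasDerivAt X (a z * X z) z)
    (h0 : X 0 = 0) : ∀ z ∈ Ico 0 δ, X z = 0 := by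
  intro z hz
  have hδ : 0 < δ := hz.1.trans_lt hz.2
  have hsub : Icc 0 z ⊆ Ico 0 δ := fun x hx => ⟨hx.1, hx.2.trans_lt hz.2⟩
  obtain ⟨C, hC⟩ := isCompact_Icc.exists_bound_of_continuousOn (ha.mono hsub)
  have hIci : 𝓝[Ico 0 δ] (0 : ℝ) = 𝓝[Ici 0] 0 := nhdsWithin_Ico_eq_nhdsGE hδ
  have hcont : ContinuousWithinAt (fun z => a z * X z) (Ici 0) 0 := by
    have := (ha.mul hc) 0 ⟨le_rfl, hδ⟩
    rwa [ContinuousWithinAt, hIci] at this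
  refine eq_zero_of_abs_deriv_le_mul_abs_self_of_eq_zero_right (K := C) (hc.mono hsub)
    (fun x hx => hasDerivWithinAt_Ici_of_Ioo hδ hX hc hcont x (hsub (Ico_subset_Icc_self hx))) h0
    (fun x hx => ?_) z (right_mem_Icc.2 hz.1)
  rw [norm_mul]
  exact mul_le_mul_of_nonneg_right (hC x (Ico_subset_Icc_self hx)) (norm_nonneg _)

/-- By the mean value theorem, integration gains one power of z. -/
lemma isBigO_sub_of_deriv {f f' : ℝ → ℝ} {δ : ℝ} (hδ : 0 < δ) (hc : ContinuousOn f (Ico 0 δ))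
    (hf : ∀ z ∈ Ioo 0 δ, HasDerivAt f (f' z) z) {n : ℕ}
    (hf' : f' =O[𝓝[>] 0] fun z => z ^ n) :
    (fun z => f z - f 0) =O[𝓝[>] 0] fun z => z ^ (n + 1) := by
  obtain ⟨C, hC0, hC⟩ := hf'.exists_nonneg
  rw [isBigOWith_iff] at hC
  obtain ⟨b, hb, hbC⟩ := mem_nhdsGT_iff_exists_Ioo_subset.1 hC
  refine IsBigO.of_bound C ?_
  filter_upwards [Ioo_mem_nhdsGT (lt_min hb hδ)] with z hz
  obtain ⟨x, hx, hxe⟩ := exists_hasDerivAt_eq_slope f f' hz.1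
    (hc.mono fun x hx => ⟨hx.1, hx.2.trans_lt (hz.2.trans_le (min_le_right _ _))⟩)
    (fun x hx => hf x ⟨hx.1, hx.2.trans (hz.2.trans_le (min_le_right _ _))⟩)
  rw [sub_zero, eq_div_iff hz.1.ne'] at hxe
  rw [← hxe, norm_mul, pow_succ, norm_mul, ← mul_assoc]
  gcongr
  have hfx : ‖f' x‖ ≤ C * ‖x ^ n‖ := hbC ⟨hx.1, hx.2.trans (hz.2.trans_le (min_le_left _ _))⟩
  refine hfx.trans ?_
  rw [norm_pow, norm_pow, Real.norm_of_nonneg hx.1.le, Real.norm_of_nonneg hz.1.le]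
  exact mul_le_mul_of_nonneg_left (pow_le_pow_left₀ hx.1.le hx.2.le n) hC0

end Calculus

/-! ### Constraints, expansions and the analytic family. -/

namespace Regularized

noncomputable section

open Set

variable {ι : Type*} [Fintype ι] [DecidableEq ι] {K : Coeffs ι} {k ℓ : ℝ}

lemma continuous_lam {ι : Type*} {k ℓ : ℝ} : Continuous (lam k ℓ : (Var ι → ℝ) → ℝ) := by
  unfold lam
  fun_prop

section FromInitial

variable {y : ℝ → Var ι → ℝ} {δ : ℝ} {c : DataAtInfinity ι}
  (hy : ∀ z ∈ Ioo 0 δ, HasDerivAt y (vectorField K k ℓ (y z)) z)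
  (hc : ContinuousOn y (Ico 0 δ)) (h0 : y 0 = initial ℓ c)

include hy hc h0

lemma curve_z_eq : ∀ z ∈ Ico 0 δ, y z .z = z := by
  intro z hz
  refine sub_eq_zero.1 (eq_zero_of_linear_deriv (X := fun z => y z .z - z) (a := fun _ => 0)
    (((continuous_apply _).comp_continuousOn hc).sub continuousOn_id) continuousOn_const
    (fun x hx => ?_) ?_ z hz)
  · refine ((hasDerivAt_pi.1 (hy x hx) .z).sub (hasDerivAt_id x)).congr_deriv ?_
    simp [vectorField]
  · simp [h0, initial]

/-- The logarithmic derivatives of T and S are opposite, so TS is conserved. -/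
lemma curve_T_mul_S : ∀ z ∈ Ico 0 δ, y z .T * y z .S = 1 := by
  intro z hz
  refine sub_eq_zero.1 (eq_zero_of_linear_deriv (X := fun z => y z .T * y z .S - 1)
    (a := fun _ => 0) ((((continuous_apply _).comp_continuousOn hc).mul
      ((continuous_apply _).comp_continuousOn hc)).sub continuousOn_const) continuousOn_const
    (fun x hx => ?_) ?_ z hz)
  · refine (((hasDerivAt_pi.1 (hy x hx) .T).mul
      (hasDerivAt_pi.1 (hy x hx) .S)).sub_const 1).congr_deriv ?_
    simp only [vectorField]
    ring
  · simp [h0, initial]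

/-- X = qλ - 1 satisfies the linear equation X' = -qλ'X with X(0) = 0. -/
lemma curve_q_mul_lam (hℓ : ℓ ≠ 0) : ∀ z ∈ Ico 0 δ, y z .q * lam k ℓ (y z) = 1 := by
  intro z hz
  have hqc : ContinuousOn (fun z => y z .q) (Ico 0 δ) := (continuous_apply _).comp_continuousOn hc
  have hdot : Continuous (lamDot K k ℓ : (Var ι → ℝ) → ℝ) := by
    unfold lamDot mDot eta aDot zeta gee pee defect lam
    fun_prop
  refine sub_eq_zero.1 (eq_zero_of_linear_deriv (X := fun z => y z .q * lam k ℓ (y z) - 1)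
    (a := fun z => -(y z .q * lamDot K k ℓ (y z)))
    ((hqc.mul (continuous_lam.comp_continuousOn hc)).sub continuousOn_const)
    (hqc.mul (hdot.comp_continuousOn hc)).neg (fun x hx => ?_) ?_ z hz)
  · have hz' : ∀ᶠ x in 𝓝 x, y x .z = x := by
      filter_upwards [Ioo_mem_nhds hx.1 hx.2] with t ht using
        curve_z_eq hy hc h0 t (Ioo_subset_Ico_self ht)
    refine (((hasDerivAt_pi.1 (hy x hx) .q).mul (deriv_lam_eq (k := k) (ℓ := ℓ) hz'
      (hasDerivAt_pi.1 (hy x hx) .m))).sub_const 1).congr_deriv ?_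
    have := hz'.self_of_nhds
    simp only [vectorField, lamDot, smul_eq_mul, this]
    ring
  · simp [h0, initial, lam, hℓ]

lemma hasExpansion_fieldsOfCurve (hδ : 0 < δ) : HasExpansion (fieldsOfCurve y) c := by
  have hIci : 𝓝[Ico 0 δ] (0 : ℝ) = 𝓝[Ici 0] 0 := nhdsWithin_Ico_eq_nhdsGE hδ
  have hy0 : Tendsto y (𝓝[>] 0) (𝓝 (y 0)) := by
    have := hc 0 ⟨le_rfl, hδ⟩
    rw [ContinuousWithinAt, hIci] at this
    exact this.mono_left (nhdsWithin_mono _ Ioi_subset_Ici_self)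
  have hO {Q : (Var ι → ℝ) → ℝ} (hQ : Continuous Q) :
      (fun z => Q (y z)) =O[𝓝[>] 0] fun _ => (1 : ℝ) :=
    ((hQ.tendsto (y 0)).comp hy0).isBigO_one ℝ
  have hvf (j : Var ι) : (fun z => vectorField K k ℓ (y z) j) =O[𝓝[>] 0] fun z : ℝ => z ^ 0 := by
    simpa using hO ((continuous_apply j).comp (contDiff_vectorField K k ℓ).continuous)
  have hcj (j : Var ι) : ContinuousOn (fun z => y z j) (Ico 0 δ) :=
    (continuous_apply j).comp_continuousOn hc
  have hdj (j : Var ι) : ∀ z ∈ Ioo 0 δ, HasDerivAt (fun z => y z j)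
      (vectorField K k ℓ (y z) j) z := fun z hz => hasDerivAt_pi.1 (hy z hz) j
  have h1 (j : Var ι) : (fun z => y z j - y 0 j) =O[𝓝[>] 0] fun z : ℝ => z ^ 1 :=
    isBigO_sub_of_deriv hδ (hcj j) (hdj j) (hvf j)
  have h2 (j j' : Var ι) (hj : ∀ x : Var ι → ℝ, vectorField K k ℓ x j = x j') :
      (fun z => y z j - (y 0 j + y 0 j' * z)) =O[𝓝[>] 0] fun z : ℝ => z ^ 2 := by
    have := isBigO_sub_of_deriv (f := fun z => y z j - y 0 j' * z) (f' := fun z => y z j' - y 0 j')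
      hδ ((hcj j).sub (by fun_prop)) (fun z hz => by
        refine ((hdj j z hz).sub ((hasDerivAt_id z).const_mul (y 0 j'))).congr_deriv ?_
        rw [hj, mul_one]) (h1 j')
    refine this.congr_left fun z => ?_
    simp only [mul_zero, sub_zero]
    ring
  -- The derivative of S is z³ times a bounded quantity.
  have hS : (fun z => y z .S - y 0 .S) =O[𝓝[>] 0] fun z : ℝ => z ^ 4 := by
    refine isBigO_sub_of_deriv hδ (hcj .S) (hdj .S) ?_
    have hb : Continuous fun x : Var ι → ℝ => -(2 * friction K x * x .S) := by
      unfold friction gee zeta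
      fun_prop
    have := (hO hb).mul (isBigO_refl (fun z : ℝ => z ^ 3) (𝓝[>] 0))
    simp only [one_mul] at this
    refine this.congr' ?_ EventuallyEq.rfl
    filter_upwards [Ioo_mem_nhdsGT hδ] with z hz
    simp only [vectorField, curve_z_eq hy hc h0 z (Ioo_subset_Ico_self hz)]
    ring
  have ht := tendsto_inv_atTop_nhdsGT_zero (𝕜 := ℝ)
  obtain ⟨M, ωinf, ω1, Einf, E1⟩ := c
  refine ⟨?_, ?_, fun i => ?_, fun i => ?_⟩
  · have := (h1 .m).comp_tendsto ht
    simpa [h0, initial, fieldsOfCurve, Function.comp_def] using this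
  · have := hS.comp_tendsto ht
    simpa [h0, initial, fieldsOfCurve, Function.comp_def] using this
  · have := (h2 (.ω i) (.v i) fun _ => rfl).comp_tendsto ht
    simpa [h0, initial, fieldsOfCurve, Function.comp_def] using this
  · have := (h2 (.E i) (.e i) fun _ => rfl).comp_tendsto ht
    simpa [h0, initial, fieldsOfCurve, Function.comp_def] using this

end FromInitial

lemma analyticAt_initial {ι : Type*} [Fintype ι] {ℓ : ℝ} (c : DataAtInfinity ι) :
    AnalyticAt ℝ (initial ℓ : DataAtInfinity ι → Var ι → ℝ) c := by
  have happ (f : DataAtInfinity ι →L[ℝ] (ι → ℝ)) (i : ι) :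
      AnalyticAt ℝ (fun c => f c i) c :=
    ((ContinuousLinearMap.proj (R := ℝ) (φ := fun _ : ι => ℝ) i).comp f).analyticAt c
  refine AnalyticAt.pi fun j => ?_
  cases j with
  | z => exact analyticAt_const
  | m => exact analyticAt_fst
  | S => exact analyticAt_const
  | T => exact analyticAt_const
  | q => exact analyticAt_const
  | ω i => exact happ ((ContinuousLinearMap.fst ℝ _ _).comp (ContinuousLinearMap.snd ℝ _ _)) i
  | v i => exact happ ((ContinuousLinearMap.fst ℝ _ _).comp ((ContinuousLinearMap.snd ℝ _ _).comp
      (ContinuousLinearMap.snd ℝ _ _))) i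
  | E i => exact happ ((ContinuousLinearMap.fst ℝ _ _).comp ((ContinuousLinearMap.snd ℝ _ _).comp
      ((ContinuousLinearMap.snd ℝ _ _).comp (ContinuousLinearMap.snd ℝ _ _)))) i
  | e i => exact happ ((ContinuousLinearMap.snd ℝ _ _).comp ((ContinuousLinearMap.snd ℝ _ _).comp
      ((ContinuousLinearMap.snd ℝ _ _).comp (ContinuousLinearMap.snd ℝ _ _)))) i

variable (K k) in
/-- The analytic family of integral curves parametrized by the data at infinity. -/
theorem exists_analytic_family (hℓ : 0 < ℓ) (c₀ : DataAtInfinity ι) :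
    ∃ ε > 0, ∃ U : Set (DataAtInfinity ι), IsOpen U ∧ c₀ ∈ U ∧
      ∃ Y : ℝ × DataAtInfinity ι → Var ι → ℝ, AnalyticOnNhd ℝ Y (Ioo (-ε) ε ×ˢ U) ∧
        ∀ c ∈ U, Y (0, c) = initial ℓ c ∧ ∀ z ∈ Ioo 0 ε,
          HasDerivAt (fun z => Y (z, c)) (vectorField K k ℓ (Y (z, c))) z ∧
          0 < Y (z, c) .S ∧ 0 < lam k ℓ (Y (z, c)) := by
  obtain ⟨y, hya, δ, hδ, hy⟩ := exists_analyticAt_flow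
    (vectorField K k ℓ (MvPolynomial.X : Var ι → MvPolynomial (Var ι) ℝ)) (initial ℓ c₀)
  simp only [eval_vectorField] at hy
  have hic := analyticAt_initial (ℓ := ℓ) c₀
  have hY : AnalyticAt ℝ (fun x : ℝ × DataAtInfinity ι => y (x.1, initial ℓ x.2)) (0, c₀) := by
    refine AnalyticAt.fun_comp (g := y) (f := fun x : ℝ × DataAtInfinity ι => (x.1, initial ℓ x.2))
      hya (analyticAt_fst.prod ?_)
    exact AnalyticAt.fun_comp (g := initial ℓ) (f := fun x : ℝ × DataAtInfinity ι => x.2)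
      hic analyticAt_snd
  have hyc := hic.continuousAt.eventually hy
  have h00 : y (0, initial ℓ c₀) = initial ℓ c₀ := hy.self_of_nhds.1
  have hS : ∀ᶠ x : ℝ × DataAtInfinity ι in 𝓝 (0, c₀), 0 < y (x.1, initial ℓ x.2) .S := by
    refine ((continuous_apply (Var.S : Var ι)).continuousAt.comp hY.continuousAt).eventually_const_lt
      ?_
    simp [h00, initial]
  have hlam : ∀ᶠ x : ℝ × DataAtInfinity ι in 𝓝 (0, c₀), 0 < lam k ℓ (y (x.1, initial ℓ x.2)) := by
    refine (continuous_lam.continuousAt.comp hY.continuousAt).eventually_const_lt ?_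
    simp only [Function.comp, h00, lam, initial]
    simp [hℓ]
  have hall := hY.eventually_analyticAt.and (hS.and hlam)
  rw [nhds_prod_eq] at hall
  obtain ⟨P, hP, Q, hQ, hPQ⟩ := eventually_prod_iff.1 hall
  obtain ⟨ε, hε, hball⟩ := Metric.eventually_nhds_iff.1 hP
  obtain ⟨U, hU, hUo, hcU⟩ := eventually_nhds_iff.1 (hQ.and hyc)
  -- `ε` bounds the domain of analyticity and positivity, `δ` the time for which the curve satisfies
  -- the equation.
  refine ⟨min ε δ, lt_min hε hδ, U, hUo, hcU,
    fun x => y (x.1, initial ℓ x.2), ?_, fun c hc => ⟨(hU c hc).2.1, fun z hz => ?_⟩⟩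
  · rintro ⟨z, c⟩ ⟨hz, hc⟩
    refine (hPQ (hball ?_) (hU c hc).1).1
    rw [Real.dist_eq, sub_zero, abs_lt]
    exact ⟨(neg_le_neg (min_le_left _ _)).trans_lt hz.1, hz.2.trans_le (min_le_left _ _)⟩
  · refine ⟨(hU c hc).2.2 z ⟨hz.1, hz.2.trans_le (min_le_right _ _)⟩,
      (hPQ (hball ?_) (hU c hc).1).2⟩
    rw [Real.dist_eq, sub_zero, abs_of_pos hz.1]
    exact hz.2.trans_le (min_le_left _ _)

end

end Regularized

/-! ### Growth and differentiation estimates for uniqueness. -/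

section Calculus

open Set

/-- A function whose logarithmic growth is controlled by a function bounded below stays bounded. -/
lemma eventually_abs_le_of_abs_deriv_le {w w' A A' : ℝ → ℝ} {δ B : ℝ} (hδ : 0 < δ)
    (hw : ∀ z ∈ Ioo 0 δ, HasDerivAt w (w' z) z) (hA : ∀ z ∈ Ioo 0 δ, HasDerivAt A (A' z) z)
    (hle : ∀ z ∈ Ioo 0 δ, |w' z| ≤ A' z * (1 + |w z|)) (hB : ∀ z ∈ Ioo 0 δ, B ≤ A z) :
    ∃ C, ∀ᶠ z in 𝓝[>] 0, |w z| ≤ C := by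
  -- This is nondecreasing since |2ww'| ≤ 2|w|(1 + |w|)A' ≤ 4(1 + w²)A'. Towards z = 0 it is
  -- therefore bounded by its value at δ/2.
  set f : ℝ → ℝ := fun z => (1 + w z ^ 2) * Real.exp (4 * A z)
  have hf : ∀ z ∈ Ioo 0 δ, HasDerivAt f
      ((2 * w z * w' z + (1 + w z ^ 2) * (4 * A' z)) * Real.exp (4 * A z)) z := by
    intro z hz
    refine ((((hw z hz).pow 2).const_add 1).mul ((hA z hz).const_mul 4).exp).congr_deriv ?_
    simp
    ring
  have hmono : MonotoneOn f (Ioo 0 δ) := by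
    refine monotoneOn_of_deriv_nonneg (convex_Ioo 0 δ)
      (fun z hz => (hf z hz).continuousAt.continuousWithinAt)
      (fun z hz => (hf z (interior_subset hz)).differentiableAt.differentiableWithinAt)
      fun z hz => ?_
    have hz := interior_subset hz
    rw [(hf z hz).deriv]
    refine mul_nonneg ?_ (Real.exp_pos _).le
    have h1 := hle z hz
    have hA0 : 0 ≤ A' z := by
      by_contra! h
      have := mul_neg_of_neg_of_pos h (by positivity : 0 < 1 + |w z|)
      linarith [abs_nonneg (w' z)]
    have h2 : -(2 * |w z| * (A' z * (1 + |w z|))) ≤ 2 * w z * w' z := by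
      have h3 : |2 * w z * w' z| ≤ 2 * |w z| * (A' z * (1 + |w z|)) := by
        rw [abs_mul, abs_mul, abs_two]
        gcongr
      exact neg_le_of_neg_le (by linarith [neg_le_abs (2 * w z * w' z)])
    have h4 : 2 * |w z| * (1 + |w z|) ≤ 4 * (1 + w z ^ 2) := by
      nlinarith [sq_nonneg (|w z| - 1), sq_abs (w z)]
    nlinarith [mul_le_mul_of_nonneg_left h4 hA0]
  refine ⟨f (δ / 2) * Real.exp (-(4 * B)), ?_⟩
  filter_upwards [Ioo_mem_nhdsGT (half_pos hδ)] with z hz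
  have hz' : z ∈ Ioo 0 δ := ⟨hz.1, hz.2.trans (half_lt_self hδ)⟩
  have h1 := hmono hz' ⟨half_pos hδ, half_lt_self hδ⟩ hz.2.le
  have h2 : |w z| ≤ 1 + w z ^ 2 := by
    nlinarith [sq_nonneg (|w z| - 1), sq_abs (w z)]
  calc |w z| ≤ (1 + w z ^ 2) * (Real.exp (4 * A z) * Real.exp (-(4 * B))) := by
        rw [← Real.exp_add]
        have : 1 ≤ Real.exp (4 * A z + -(4 * B)) := Real.one_le_exp (by linarith [hB z hz'])
        exact h2.trans (le_mul_of_one_le_right (by positivity) this)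
    _ = f z * Real.exp (-(4 * B)) := by ring
    _ ≤ _ := mul_le_mul_of_nonneg_right h1 (Real.exp_pos _).le

/-- A first-order expansion at `0` can be differentiated if the second derivative is bounded. -/
lemma tendsto_deriv_of_isBigO {w v v' : ℝ → ℝ} {δ C a b : ℝ} (hδ : 0 < δ)
    (hw : ∀ z ∈ Ioo 0 δ, HasDerivAt w (v z) z) (hv : ∀ z ∈ Ioo 0 δ, HasDerivAt v (v' z) z)
    (hC : ∀ z ∈ Ioo 0 δ, |v' z| ≤ C)
    (h : (fun z => w z - (a + b * z)) =O[𝓝[>] 0] fun z : ℝ => z ^ 2) :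
    Tendsto v (𝓝[>] 0) (𝓝 b) := by
  obtain ⟨D, hD⟩ := h.bound
  obtain ⟨d, hd, hdD⟩ := mem_nhdsGT_iff_exists_Ioo_subset.1 hD
  have hd : 0 < d := hd
  have hlim : Tendsto (fun z : ℝ => (C + 5 * D) * z) (𝓝[>] 0) (𝓝 0) := by
    have : Tendsto (fun z : ℝ => (C + 5 * D) * z) (𝓝 0) (𝓝 ((C + 5 * D) * 0)) :=
      tendsto_id.const_mul _
    rw [mul_zero] at this
    exact this.mono_left nhdsWithin_le_nhds
  rw [tendsto_iff_dist_tendsto_zero]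
  refine squeeze_zero' (Eventually.of_forall fun _ => dist_nonneg) ?_ hlim
  filter_upwards [Ioo_mem_nhdsGT (half_pos (lt_min hd hδ))] with z hz
  have h2 : 2 * z < min d δ := by linarith [hz.2]
  have h2d := h2.trans_le (min_le_left _ _)
  have h2δ := h2.trans_le (min_le_right _ _)
  have hz0 := hz.1
  have hmem : ∀ x, z ≤ x → x ≤ 2 * z → x ∈ Ioo 0 δ := fun x h h' => ⟨by linarith, by linarith⟩
  -- The slope over [z, 2z] equals v(ξ). The remainders Dz² and D(2z)² put it within 5Dz of b, and
  -- the bound on v' puts v(z) within Cz of v(ξ).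
  obtain ⟨ξ, hξ, hξe⟩ := exists_hasDerivAt_eq_slope w v (by linarith : z < 2 * z)
    (fun x hx => (hw x (hmem x hx.1 hx.2)).continuousAt.continuousWithinAt)
    (fun x hx => hw x (hmem x hx.1.le hx.2.le))
  obtain ⟨x, hx, hxe⟩ := exists_hasDerivAt_eq_slope v v' hξ.1
    (fun x hx => (hv x (hmem x hx.1 (hx.2.trans hξ.2.le))).continuousAt.continuousWithinAt)
    (fun x hx => hv x (hmem x hx.1.le (hx.2.le.trans hξ.2.le)))
  rw [eq_div_iff (by linarith)] at hξe
  rw [eq_div_iff (by linarith [hξ.1])] at hxe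
  have hw1 : |w z - (a + b * z)| ≤ D * z ^ 2 := by
    have : ‖w z - (a + b * z)‖ ≤ D * ‖z ^ 2‖ := hdD ⟨hz0, by linarith⟩
    rwa [Real.norm_of_nonneg (sq_nonneg z)] at this
  have hw2 : |w (2 * z) - (a + b * (2 * z))| ≤ D * (2 * z) ^ 2 := by
    have : ‖w (2 * z) - (a + b * (2 * z))‖ ≤ D * ‖(2 * z) ^ 2‖ := hdD ⟨by linarith, h2d⟩
    rwa [Real.norm_of_nonneg (sq_nonneg _)] at this
  have h3 : |v ξ - b| ≤ 5 * D * z := by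
    have : |v ξ - b| * z ≤ 5 * D * z * z := by
      rw [← abs_of_pos hz0, ← abs_mul, abs_of_pos hz0]
      have : (v ξ - b) * z = (w (2 * z) - (a + b * (2 * z))) - (w z - (a + b * z)) := by
        linear_combination hξe
      rw [this]
      refine (abs_sub _ _).trans ?_
      linarith
    exact le_of_mul_le_mul_right this hz0
  have h4 : |v ξ - v z| ≤ C * z := by
    rw [← hxe, abs_mul, abs_of_pos (by linarith [hξ.1] : 0 < ξ - z)]
    have hx' := hC x (hmem x hx.1.le (hx.2.le.trans hξ.2.le))
    exact mul_le_mul hx' (by linarith [hξ.2]) (by linarith [hξ.1]) ((abs_nonneg _).trans hx')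
  rw [Real.dist_eq]
  calc |v z - b| = |(v ξ - b) - (v ξ - v z)| := by ring_nf
    _ ≤ |v ξ - b| + |v ξ - v z| := abs_sub _ _
    _ ≤ _ := by linarith

/-- This is the shape of the equations for v and e: h is η or G, rescaled, and s their sum. -/
lemma abs_affine_le {a₀ a₁ b h s v C₀ C₁ C₂ : ℝ} (h0 : |a₀| ≤ C₀) (h1 : |a₁| ≤ C₁) (h2 : |b| ≤ C₂)
    (hh : 0 ≤ h) (hs : h ≤ s) :
    |a₀ * v + a₁ * h * v + b| ≤ (C₀ + C₁ + C₂) * (1 + s) * (1 + |v|) := by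
  have hv := abs_nonneg v
  have hs0 := hh.trans hs
  have hC0 := (abs_nonneg _).trans h0
  have hC1 := (abs_nonneg _).trans h1
  have hC2 := (abs_nonneg _).trans h2
  have e0 : |a₀ * v| ≤ C₀ * ((1 + s) * (1 + |v|)) := by
    rw [abs_mul]
    exact mul_le_mul h0 (by nlinarith [mul_nonneg hs0 hv]) hv hC0
  have e1 : |a₁ * h * v| ≤ C₁ * ((1 + s) * (1 + |v|)) := by
    rw [abs_mul, abs_mul, abs_of_nonneg hh, mul_assoc]
    exact mul_le_mul h1 (by nlinarith [mul_le_mul_of_nonneg_right hs hv]) (by positivity) hC1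
  have e2 : |b| ≤ C₂ * ((1 + s) * (1 + |v|)) :=
    h2.trans (le_mul_of_one_le_right hC2 (by nlinarith [mul_nonneg hs0 hv]))
  calc _ ≤ |a₀ * v| + |a₁ * h * v| + |b| := abs_add_three _ _ _
    _ ≤ _ := by linarith

end Calculus

/-! ### Convergence at infinity and uniqueness. -/

namespace Regularized

noncomputable section

open Set

variable {ι : Type*} [Fintype ι] [DecidableEq ι] {K : Coeffs ι} {k ℓ : ℝ}

/-- The regularized unknowns without the derivatives `v_i`, `e_i`. -/
def prune {ι : Type*} (x : Var ι → ℝ) : Var ι → ℝ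
  | .v _ => 0
  | .e _ => 0
  | j => x j

lemma eta_nonneg (hh : ∀ x : ι → ℝ, 0 ≤ ∑ i, ∑ j, x i * K.h i j * x j) (x : Var ι → ℝ) :
    0 ≤ eta K x := by
  refine mul_nonneg (by norm_num) ((hh (aDot K x)).trans_eq ?_)
  exact Finset.sum_congr rfl fun i _ => Finset.sum_congr rfl fun j _ => by
    rw [smul_eq_mul]
    ring

lemma zeta_nonneg {ι : Type*} [Fintype ι] {K : Coeffs ι} (hn : ∀ i, 0 < K.normSq i)
    (x : Var ι → ℝ) : 0 ≤ zeta K x :=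
  Finset.sum_nonneg fun i _ => smul_nonneg (inv_nonneg.2 (hn i).le) (by positivity)

lemma gee_nonneg {ι : Type*} [Fintype ι] {K : Coeffs ι} (hn : ∀ i, 0 < K.normSq i)
    (x : Var ι → ℝ) : 0 ≤ gee K x :=
  Finset.sum_nonneg fun i _ => smul_nonneg (inv_nonneg.2 (hn i).le) (by positivity)

section Limit

variable {Φ : Fields ι} {c : DataAtInfinity ι}

lemma isBigO_state_of_hasExpansion {ι : Type*} {k ℓ : ℝ} {Φ : Fields ι} {c : DataAtInfinity ι}
    (hexp : HasExpansion Φ c) :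
    ((fun z => state k ℓ Φ z .m - initial ℓ c .m) =O[𝓝[>] 0] fun z : ℝ => z) ∧
    ((fun z => state k ℓ Φ z .S - initial ℓ c .S) =O[𝓝[>] 0] fun z : ℝ => z ^ 4) ∧
    (∀ i, (fun z => state k ℓ Φ z (.ω i) - (initial ℓ c (.ω i) + initial ℓ c (.v i) * z))
      =O[𝓝[>] 0] fun z : ℝ => z ^ 2) ∧
    (∀ i, (fun z => state k ℓ Φ z (.E i) - (initial ℓ c (.E i) + initial ℓ c (.e i) * z))
      =O[𝓝[>] 0] fun z : ℝ => z ^ 2) := by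
  obtain ⟨M, ωinf, ω1, Einf, E1⟩ := c
  obtain ⟨h1, h2, h3, h4⟩ := hexp
  have ht := tendsto_inv_nhdsGT_zero (𝕜 := ℝ)
  refine ⟨?_, ?_, fun i => ?_, fun i => ?_⟩
  · have := h1.comp_tendsto ht
    simp only [Function.comp_def, inv_inv] at this
    exact this
  · simpa [Function.comp_def, state, initial] using h2.comp_tendsto ht
  · simpa [Function.comp_def, state, initial] using (h3 i).comp_tendsto ht
  · simpa [Function.comp_def, state, initial] using (h4 i).comp_tendsto ht

/-- All unknowns other than v and e converge directly from the expansions. Quantities free of v and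
e take the same value on the pruned state, so they are controlled at once. -/
lemma tendsto_prune_state {ι : Type*} {k ℓ : ℝ} {Φ : Fields ι} {c : DataAtInfinity ι}
    (hℓ : 0 < ℓ) (hexp : HasExpansion Φ c) :
    Tendsto (fun z => prune (state k ℓ Φ z)) (𝓝[>] 0) (𝓝 (prune (initial ℓ c))) := by
  obtain ⟨h1, h2, h3, h4⟩ := isBigO_state_of_hasExpansion (k := k) (ℓ := ℓ) hexp
  have hid : Tendsto (fun z : ℝ => z) (𝓝[>] 0) (𝓝 0) := tendsto_id.mono_left nhdsWithin_le_nhds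
  have hpow (n : ℕ) (hn : n ≠ 0) : Tendsto (fun z : ℝ => z ^ n) (𝓝[>] 0) (𝓝 0) := by
    simpa [hn] using hid.pow n
  have hm : Tendsto (fun z => state k ℓ Φ z .m) (𝓝[>] 0) (𝓝 (initial ℓ c .m)) :=
    tendsto_sub_nhds_zero_iff.1 (h1.trans_tendsto hid)
  have hS : Tendsto (fun z => state k ℓ Φ z .S) (𝓝[>] 0) (𝓝 (initial ℓ c .S)) :=
    tendsto_sub_nhds_zero_iff.1 (h2.trans_tendsto (hpow 4 (by norm_num)))
  have haff {f : ℝ → ℝ} {a b : ℝ} (h : (fun z => f z - (a + b * z)) =O[𝓝[>] 0] fun z : ℝ => z ^ 2) :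
      Tendsto f (𝓝[>] 0) (𝓝 a) := by
    have h5 := (h.trans_tendsto (hpow 2 (by norm_num))).add ((hid.const_mul b).const_add a)
    simp only [sub_add_cancel, mul_zero, add_zero, zero_add] at h5
    exact h5
  refine tendsto_pi_nhds.2 fun j => ?_
  cases j with
  | z => exact hid
  | m => exact hm
  | S => exact hS
  | T =>
    have := hS.inv₀ (by simp [initial])
    simpa [prune, state, initial] using this
  | q =>
    have hl : Tendsto (fun z => (ℓ ^ 2)⁻¹ + k * z ^ 2 - 2 * state k ℓ Φ z .m * z ^ 3) (𝓝[>] 0)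
        (𝓝 ((ℓ ^ 2)⁻¹ + k * 0 - 2 * initial ℓ c .m * 0)) :=
      (((hpow 2 (by norm_num)).const_mul k).const_add _).sub
        ((hm.const_mul 2).mul (hpow 3 (by norm_num)))
    have := hl.inv₀ (by simp [hℓ.ne'])
    simpa [prune, state, initial] using this
  | ω i => exact haff (h3 i)
  | E i => exact haff (h4 i)
  | v i => exact tendsto_const_nhds
  | e i => exact tendsto_const_nhds

/-- The regularized unknowns of a solution with the given expansions converge as `z → 0`. This is
where the positivity of the inner product enters. -/
theorem tendsto_state (hn : ∀ i, 0 < K.normSq i)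
    (hh : ∀ x : ι → ℝ, 0 ≤ ∑ i, ∑ j, x i * K.h i j * x j) (hℓ : 0 < ℓ) {R : ℝ} (hR : 0 < R)
    (hΦ : IsSolutionBeyond K k ℓ R Φ) (hexp : HasExpansion Φ c) :
    Tendsto (state k ℓ Φ) (𝓝[>] 0) (𝓝 (initial ℓ c)) := by
  have hp := tendsto_prune_state (k := k) hℓ hexp
  set y := state k ℓ Φ
  have hR' : 0 < R⁻¹ := inv_pos.2 hR
  have hy : ∀ z ∈ Ioo 0 R⁻¹, HasDerivAt y (vectorField K k ℓ (y z)) z := fun z hz =>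
    hasDerivAt_state hℓ hR hΦ hz
  have hyj (j : Var ι) : ∀ z ∈ Ioo 0 R⁻¹, HasDerivAt (fun z => y z j)
      (vectorField K k ℓ (y z) j) z := fun z hz => hasDerivAt_pi.1 (hy z hz) j
  have hQ {Q : (Var ι → ℝ) → ℝ} (hQ : Continuous Q) :
      ∃ C, ∀ᶠ z in 𝓝[>] 0, |Q (prune (y z))| ≤ C :=
    ⟨|Q (prune (initial ℓ c))| + 1, ((hQ.abs.tendsto _).comp hp).eventually_le_const (by
      simp)⟩
  have hlower {Q : (Var ι → ℝ) → ℝ} (hQ : Continuous Q) {a : ℝ}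
      (ha : a < Q (prune (initial ℓ c))) : ∀ᶠ z in 𝓝[>] 0, a ≤ Q (prune (y z)) :=
    ((hQ.tendsto _).comp hp).eventually_const_le ha
  obtain ⟨Cp, hCp⟩ := hQ (Q := pee K k) (by unfold pee defect; fun_prop)
  obtain ⟨Cm, hCm⟩ := hQ (Q := fun x => x .m) (by fun_prop)
  have hT := hlower (Q := fun x => x .T ^ 2) (a := 1 / 2) (by fun_prop)
    (by norm_num [prune, initial])
  have hl := hlower (Q := lam k ℓ) (a := (ℓ ^ 2)⁻¹ / 2) continuous_lam (by
    simp [lam, prune, initial, hℓ])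
  -- A common lower bound for T² → 1 and λ → 1/ℓ², the coefficients of η and G in -dm/dz.
  set c₁ := min (1 / 2) ((ℓ ^ 2)⁻¹ / 2)
  have hc₁ : 0 < c₁ := lt_min (by norm_num) (by positivity)
  -- In -dm/dz = ηT² + ζqT² + λG + P, with η and G rescaled, only P may be negative, and it is
  -- bounded.
  have henergy : ∀ᶠ z in 𝓝[>] 0,
      eta K (y z) + gee K (y z) ≤ (-vectorField K k ℓ (y z) .m + Cp) / c₁ := by
    filter_upwards [hCp, hT, hl] with z h1 h2 h3
    replace h1 : |pee K k (y z)| ≤ Cp := h1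
    replace h2 : 1 / 2 ≤ y z .T ^ 2 := h2
    replace h3 : (ℓ ^ 2)⁻¹ / 2 ≤ lam k ℓ (y z) := h3
    have hq : 0 ≤ y z .q := by
      change 0 ≤ state k ℓ Φ z .q
      rw [state_q]
      exact inv_nonneg.2 (le_trans (by positivity) h3)
    rw [le_div_iff₀ hc₁]
    simp only [vectorField, mDot]
    have e1 := mul_le_mul_of_nonneg_left ((min_le_left _ _ : c₁ ≤ _).trans h2) (eta_nonneg hh (y z))
    have e2 := mul_le_mul_of_nonneg_right ((min_le_right _ _ : c₁ ≤ _).trans h3)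
      (gee_nonneg hn (y z))
    have e3 : 0 ≤ zeta K (y z) * y z .q * y z .T ^ 2 :=
      mul_nonneg (mul_nonneg (zeta_nonneg hn _) hq) (sq_nonneg _)
    have e4 := neg_le_of_abs_le h1
    linarith
  -- The energy bound makes the growth rate at most the derivative of C(z + (-m + Cp z)/c₁), which
  -- is bounded below because m is bounded.
  have hbdd (j : Var ι) (C : ℝ) (hC : 0 ≤ C) (h : ∀ᶠ z in 𝓝[>] 0, |vectorField K k ℓ (y z) j| ≤
      C * (1 + (eta K (y z) + gee K (y z))) * (1 + |y z j|)) :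
      ∃ B, ∀ᶠ z in 𝓝[>] 0, |y z j| ≤ B := by
    obtain ⟨δ, hδ, hsub⟩ := mem_nhdsGT_iff_exists_Ioo_subset.1
      (((h.and henergy).and hCm).and (Ioo_mem_nhdsGT hR'))
    refine eventually_abs_le_of_abs_deriv_le hδ (fun z hz => hyj j z (hsub hz).2)
      (A := fun z => C * (z + (-y z .m + Cp * z) / c₁))
      (A' := fun z => C * (1 + (-vectorField K k ℓ (y z) .m + Cp) / c₁))
      (B := C * (0 + (-Cm + -(|Cp| * δ)) / c₁)) (fun z hz => ?_) (fun z hz => ?_) (fun z hz => ?_)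
    · refine (((hasDerivAt_id z).add (((hyj .m z (hsub hz).2).neg.add
        ((hasDerivAt_id z).const_mul Cp)).div_const c₁)).const_mul C).congr_deriv ?_
      ring
    · refine (hsub hz).1.1.1.trans ?_
      have := (hsub hz).1.1.2
      gcongr
    · have h1 : y z .m ≤ Cm := (le_abs_self _).trans (hsub hz).1.2
      have h2 : -(|Cp| * δ) ≤ Cp * z := by
        have h3 : |Cp * z| ≤ |Cp| * δ := by
          rw [abs_mul, abs_of_pos hz.1]
          exact mul_le_mul_of_nonneg_left hz.2.le (abs_nonneg _)
        exact neg_le_of_abs_le h3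
      have := hz.1.le
      gcongr
  have hv (i : ι) : ∃ B, ∀ᶠ z in 𝓝[>] 0, |y z (.v i)| ≤ B := by
    obtain ⟨C₀, h₀⟩ := hQ (Q := fun x => -(2 * x .q * (k * x .z - 3 * x .m * x .z ^ 2
      + pee K k x * x .z ^ 3))) (by unfold pee defect; fun_prop)
    obtain ⟨C₁, h₁⟩ := hQ (Q := fun x => -(2 * x .q * x .z ^ 3 * x .T ^ 2)) (by fun_prop)
    obtain ⟨C₂, h₂⟩ := hQ (Q := fun x => -(x .q * (x (.E i) ^ 2 * x (.ω i) * x .q * x .T ^ 2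
      + eff K k x i))) (by unfold eff defect; fun_prop)
    have hC : 0 ≤ C₀ + C₁ + C₂ := by
      obtain ⟨z, h3, h4, h5⟩ := (h₀.and (h₁.and h₂)).exists
      linarith [(abs_nonneg _).trans h3, (abs_nonneg _).trans h4, (abs_nonneg _).trans h5]
    refine hbdd (.v i) _ hC ?_
    filter_upwards [h₀, h₁, h₂] with z h3 h4 h5
    refine le_trans (le_of_eq ?_) (abs_affine_le h3 h4 h5 (eta_nonneg hh (y z))
      (le_add_of_nonneg_right (gee_nonneg hn (y z))))
    change |-(y z .q * (2 * y z (.v i) * (k * y z .z - 3 * y z .m * y z .z ^ 2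
      + pee K k (y z) * y z .z ^ 3 + y z .z ^ 3 * eta K (y z) * y z .T ^ 2)
      + y z (.E i) ^ 2 * y z (.ω i) * y z .q * y z .T ^ 2 + eff K k (y z) i))| =
      |-(2 * y z .q * (k * y z .z - 3 * y z .m * y z .z ^ 2 + pee K k (y z) * y z .z ^ 3))
        * y z (.v i) + -(2 * y z .q * y z .z ^ 3 * y z .T ^ 2) * eta K (y z) * y z (.v i)
        + -(y z .q * (y z (.E i) ^ 2 * y z (.ω i) * y z .q * y z .T ^ 2 + eff K k (y z) i))|
    congr 1
    ring
  have he (i : ι) : ∃ B, ∀ᶠ z in 𝓝[>] 0, |y z (.e i)| ≤ B := by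
    obtain ⟨C₀, h₀⟩ := hQ (Q := fun x => -(2 * x .z ^ 3 * (zeta K x * x .q ^ 2 * x .T ^ 2)))
      (by unfold zeta; fun_prop)
    obtain ⟨C₁, h₁⟩ := hQ (Q := fun x => -(2 * x .z ^ 3)) (by fun_prop)
    obtain ⟨C₂, h₂⟩ := hQ (Q := fun x => zed K x i * x .q) (by unfold zed; fun_prop)
    have hC : 0 ≤ C₀ + C₁ + C₂ := by
      obtain ⟨z, h3, h4, h5⟩ := (h₀.and (h₁.and h₂)).exists
      linarith [(abs_nonneg _).trans h3, (abs_nonneg _).trans h4, (abs_nonneg _).trans h5]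
    refine hbdd (.e i) _ hC ?_
    filter_upwards [h₀, h₁, h₂] with z h3 h4 h5
    refine le_trans (le_of_eq ?_) (abs_affine_le h3 h4 h5 (gee_nonneg hn (y z))
      (le_add_of_nonneg_left (eta_nonneg hh (y z))))
    change |zed K (y z) i * y z .q - 2 * y z .z ^ 3
        * (gee K (y z) + zeta K (y z) * y z .q ^ 2 * y z .T ^ 2) * y z (.e i)| =
      |-(2 * y z .z ^ 3 * (zeta K (y z) * y z .q ^ 2 * y z .T ^ 2)) * y z (.e i)
        + -(2 * y z .z ^ 3) * gee K (y z) * y z (.e i) + zed K (y z) i * y z .q|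
    congr 1
    ring
  have hpj (j : Var ι) : Tendsto (fun z => prune (y z) j) (𝓝[>] 0) (𝓝 (prune (initial ℓ c) j)) :=
    tendsto_pi_nhds.1 hp j
  have hbig : y =O[𝓝[>] 0] fun _ => (1 : ℝ) := by
    have hbound {j : Var ι} (h : ∃ B, ∀ᶠ z in 𝓝[>] 0, |y z j| ≤ B) :
        (fun z => y z j) =O[𝓝[>] 0] fun _ => (1 : ℝ) := by
      obtain ⟨B, hB⟩ := h
      exact IsBigO.of_bound B (by simpa using hB)
    refine isBigO_pi.2 fun j => ?_
    cases j with
    | v i => exact hbound (hv i)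
    | e i => exact hbound (he i)
    | z => exact (hpj .z).isBigO_one ℝ
    | m => exact (hpj .m).isBigO_one ℝ
    | S => exact (hpj .S).isBigO_one ℝ
    | T => exact (hpj .T).isBigO_one ℝ
    | q => exact (hpj .q).isBigO_one ℝ
    | ω i => exact (hpj (.ω i)).isBigO_one ℝ
    | E i => exact (hpj (.E i)).isBigO_one ℝ
  -- With all unknowns bounded, so is the vector field, in particular dv/dz and de/dz; the
  -- expansions of ω and E may then be differentiated.
  obtain ⟨B, hB⟩ := hbig.bound
  obtain ⟨C, hC⟩ := (isCompact_closedBall (0 : Var ι → ℝ) B).exists_bound_of_continuousOn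
    (contDiff_vectorField K k ℓ).continuous.continuousOn
  obtain ⟨δ, hδ, hsub⟩ := mem_nhdsGT_iff_exists_Ioo_subset.1 (hB.and (Ioo_mem_nhdsGT hR'))
  have hder (j : Var ι) : ∀ z ∈ Ioo 0 δ, |vectorField K k ℓ (y z) j| ≤ C := fun z hz => by
    refine (norm_le_pi_norm (vectorField K k ℓ (y z)) j).trans (hC _ ?_)
    simpa using (hsub hz).1
  obtain ⟨-, -, h3, h4⟩ := isBigO_state_of_hasExpansion (k := k) (ℓ := ℓ) hexp
  refine tendsto_pi_nhds.2 fun j => ?_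
  cases j with
  | v i =>
    exact tendsto_deriv_of_isBigO hδ (v := fun z => y z (.v i))
      (fun z hz => hyj (.ω i) z (hsub hz).2) (fun z hz => hyj (.v i) z (hsub hz).2) (hder _) (h3 i)
  | e i =>
    exact tendsto_deriv_of_isBigO hδ (v := fun z => y z (.e i))
      (fun z hz => hyj (.E i) z (hsub hz).2) (fun z hz => hyj (.e i) z (hsub hz).2) (hder _) (h4 i)
  | z => exact hpj .z
  | m => exact hpj .m
  | S => exact hpj .S
  | T => exact hpj .T
  | q => exact hpj .q
  | ω i => exact hpj (.ω i)
  | E i => exact hpj (.E i)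

/-- A solution with given data at infinity agrees with the integral curve from these data. -/
theorem state_eq_of_hasExpansion (hn : ∀ i, 0 < K.normSq i)
    (hh : ∀ x : ι → ℝ, 0 ≤ ∑ i, ∑ j, x i * K.h i j * x j) (hℓ : 0 < ℓ) {R : ℝ} (hR : 0 < R)
    (hΦ : IsSolutionBeyond K k ℓ R Φ) (hexp : HasExpansion Φ c) {y : ℝ → Var ι → ℝ} {δ z : ℝ}
    (hy : ∀ z ∈ Ioo 0 δ, HasDerivAt y (vectorField K k ℓ (y z)) z)
    (hc : ContinuousOn y (Ico 0 δ)) (h0 : y 0 = initial ℓ c) (hz : 0 < z) (hzR : z < R⁻¹)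
    (hzδ : z < δ) : state k ℓ Φ z = y z := by
  have hvc := (contDiff_vectorField K k ℓ).continuous
  -- At z = 0 `state` reads the fields at the meaningless radius `0⁻¹ = 0`, so its value there is
  -- replaced by the limit.
  set x : ℝ → Var ι → ℝ := Function.update (state k ℓ Φ) 0 (initial ℓ c)
  have hx0 : x 0 = initial ℓ c := Function.update_self _ _ _
  have hxs : ∀ t, t ≠ 0 → x t = state k ℓ Φ t := fun t ht => Function.update_of_ne ht _ _
  have hxd : ∀ t ∈ Ioo 0 R⁻¹, HasDerivAt x (vectorField K k ℓ (x t)) t := by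
    intro t ht
    rw [hxs t ht.1.ne']
    refine (hasDerivAt_state hℓ hR hΦ ht).congr_of_eventuallyEq ?_
    filter_upwards [lt_mem_nhds ht.1] with s hs using hxs s hs.ne'
  have hxc : ContinuousOn x (Ico 0 R⁻¹) := by
    intro t ht
    rcases ht.1.eq_or_lt with rfl | h
    · have h1 : Tendsto x (𝓝[>] 0) (𝓝 (x 0)) := by
        rw [hx0]
        refine (tendsto_state hn hh hℓ hR hΦ hexp).congr' ?_
        filter_upwards [self_mem_nhdsWithin] with s hs using (hxs s (ne_of_gt hs)).symm
      have h2 : ContinuousWithinAt x (Ici 0) 0 :=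
        continuousWithinAt_Ioi_iff_Ici.1 h1
      exact h2.mono Ico_subset_Ici_self
    · exact (hxd t ⟨h, ht.2⟩).continuousAt.continuousWithinAt
  have hIci {u : ℝ → Var ι → ℝ} {d : ℝ} (hd : 0 < d) (hu : ContinuousOn u (Ico 0 d)) :
      ContinuousWithinAt (fun t => vectorField K k ℓ (u t)) (Ici 0) 0 := by
    have := (hvc.comp_continuousOn hu) 0 ⟨le_rfl, hd⟩
    rwa [ContinuousWithinAt, nhdsWithin_Ico_eq_nhdsGE hd] at this
  have hR' := hz.trans hzR
  have hδ := hz.trans hzδ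
  have := eqOn_Icc_of_hasDerivWithinAt (contDiff_vectorField K k ℓ) (a := 0) (b := z)
    (hxc.mono fun t ht => ⟨ht.1, ht.2.trans_lt hzR⟩)
    (fun t ht => hasDerivWithinAt_Ici_of_Ioo hR' hxd hxc (hIci hR' hxc) t
      ⟨ht.1, ht.2.trans hzR⟩)
    (hc.mono fun t ht => ⟨ht.1, ht.2.trans_lt hzδ⟩)
    (fun t ht => hasDerivWithinAt_Ici_of_Ioo hδ hy hc (hIci hδ hc) t
      ⟨ht.1, ht.2.trans hzδ⟩) (hx0.trans h0.symm) (right_mem_Icc.2 hz.le)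
  rw [← hxs z hz.ne', this]

end Limit

variable (K k) in
/-- The local existence and uniqueness theorem for constants with the positivity properties of an
inner product. -/
theorem exists_family (hn : ∀ i, 0 < K.normSq i)
    (hh : ∀ x : ι → ℝ, 0 ≤ ∑ i, ∑ j, x i * K.h i j * x j) (hℓ : 0 < ℓ) (c₀ : DataAtInfinity ι) :
    ∃ ε > 0, ∃ U : Set (DataAtInfinity ι), IsOpen U ∧ c₀ ∈ U ∧ ∃ Ψ : FieldFamily ι,
      Ψ.IsAnalyticOn (Ioo (-ε) ε ×ˢ U) ∧ ∀ c ∈ U,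
        IsSolutionBeyond K k ℓ ε⁻¹ (Ψ.member c) ∧ HasExpansion (Ψ.member c) c ∧
        ∀ R > 0, ∀ Φ : Fields ι, IsSolutionBeyond K k ℓ R Φ → HasExpansion Φ c →
          ∀ r, R < r → ε⁻¹ < r → Φ.AgreeAt (Ψ.member c) r := by
  obtain ⟨ε, hε, U, hU, hcU, Y, hYa, hY⟩ := exists_analytic_family K k hℓ c₀
  have hYj (j : Var ι) : AnalyticOnNhd ℝ (fun x => Y x j) (Ioo (-ε) ε ×ˢ U) := fun x hx =>
    analyticAt_pi_iff.1 (hYa x hx) j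
  refine ⟨ε, hε, U, hU, hcU, ⟨fun x => Y x .m, fun x => Y x .S, fun i x => Y x (.ω i),
    fun i x => Y x (.E i)⟩, ⟨hYj .m, hYj .S, fun i => hYj (.ω i), fun i => hYj (.E i)⟩,
    fun c hc => ?_⟩
  set y : ℝ → Var ι → ℝ := fun z => Y (z, c)
  have hy : ∀ z ∈ Ioo 0 ε, HasDerivAt y (vectorField K k ℓ (y z)) z := fun z hz =>
    ((hY c hc).2 z hz).1
  have hyc : ContinuousOn y (Ico 0 ε) := fun z hz =>
    (ContinuousAt.comp (f := fun z : ℝ => (z, c))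
      (hYa (z, c) ⟨⟨(neg_lt_zero.2 hε).trans_le hz.1, hz.2⟩, hc⟩).continuousAt
      (by fun_prop)).continuousWithinAt
  have h0 : y 0 = initial ℓ c := (hY c hc).1
  refine ⟨?_, hasExpansion_fieldsOfCurve hy hyc h0 hε, fun R hR Φ hΦ hexp r hRr hεr => ?_⟩
  · exact isSolutionBeyond_fieldsOfCurve hy
      (fun z hz => curve_z_eq hy hyc h0 z (Ioo_subset_Ico_self hz))
      (fun z hz => ((hY c hc).2 z hz).2.1) (fun z hz => ((hY c hc).2 z hz).2.2)
      (fun z hz => curve_T_mul_S hy hyc h0 z (Ioo_subset_Ico_self hz))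
      (fun z hz => curve_q_mul_lam hy hyc h0 hℓ.ne' z (Ioo_subset_Ico_self hz)) hℓ hε
  · have hr : 0 < r := hR.trans hRr
    have h := state_eq_of_hasExpansion hn hh hℓ hR hΦ hexp hy hyc h0 (inv_pos.2 hr)
      ((inv_lt_inv₀ hr hR).2 hRr) (inv_lt_of_inv_lt₀ hε hεr)
    have hj (j : Var ι) : state k ℓ Φ r⁻¹ j = y r⁻¹ j := congrFun h j
    refine ⟨?_, ?_, fun i => ?_, fun i => ?_⟩
    · simpa [state, y, FieldFamily.member] using hj .m
    · simpa [state, y, FieldFamily.member] using hj .S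
    · simpa [state, y, FieldFamily.member] using hj (.ω i)
    · simpa [state, y, FieldFamily.member] using hj (.E i)

end

end Regularized

end EYM

open EYM in
theorem mainTheorem7 {g : Type*} [LieRing g] [LieAlgebra ℂ g] [FiniteDimensional ℂ g]
    [LieAlgebra.IsKilling ℂ g] (H : LieSubalgebra ℂ g) [H.IsCartanSubalgebra]
    (B : LinearMap.BilinForm ℂ g) (hB : IsAdmissibleForm B)
    (b : (LieAlgebra.IsKilling.rootSystem H).Base)
    (W₀ : H) (hW₀ : InOpenWeylChamber b W₀) (hA₁ : IsA1Vector W₀)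
    (k : ℝ) (hk : k = 1 ∨ k = 0 ∨ k = -1) (ℓ : ℝ) (hℓ : 0 < ℓ)
    (c₀ : DataAtInfinity (sigmaW W₀)) :
    ∃ ε > 0, ∃ U : Set (DataAtInfinity (sigmaW W₀)), IsOpen U ∧ c₀ ∈ U ∧
      ∃ Ψ : FieldFamily (sigmaW W₀),
        Ψ.IsAnalyticOn (Set.Ioo (-ε) ε ×ˢ U) ∧
        ∀ c ∈ U,
          IsSolutionBeyond (modelCoeffs B W₀) k ℓ ε⁻¹ (Ψ.member c) ∧
          HasExpansion (Ψ.member c) c ∧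
          ∀ R > 0, ∀ Φ : Fields (sigmaW W₀),
            IsSolutionBeyond (modelCoeffs B W₀) k ℓ R Φ → HasExpansion Φ c →
              ∀ r, R < r → ε⁻¹ < r → Φ.AgreeAt (Ψ.member c) r := by
  exact Regularized.exists_family _ k (modelCoeffs_normSq_pos hB W₀) (modelCoeffs_h_nonneg hB W₀)
    hℓ c₀
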